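/- Let $N\ge 1$ and let $\mathcal H(N)$ be the real vector space of $N\times N$ complex Hermitian matrices, $\mathfrak V\subset\mathcal H(N)$ the set of matrices having a multiple eigenvalue and, for positive integers $n_1,\dots,n_{\bar N}$ with $\sum_k n_k=N$ (order disregarded), $\mathfrak M_{n}=\mathfrak M_{n_1,\dots,n_{\bar N}}$ the set of matrices whose distinct eigenvalues have multiplicities $n_1,\dots,n_{\bar N}$. Put $c(n)=\bigl(\sum_k n_k^2\bigr)-\bar N$. Call a property generic if it holds exactly on an open dense set. Fix $H_0\in\mathcal H(N)\setminus\mathfrak V$, and for $d\ge 0$ let $\mathcal F_d$ be the space of continuous families $\theta\mapsto H_\theta$, $\mathbb R^d\to\mathcal H(N)$, starting at the given matrix $H_0$ (for $\theta=0$), with the topology of uniform convergence on compact sets. Say that $d$-parameter families generically avoid $S\subset\mathcal H(N)$ if for every compact $K\subset\mathbb R^d$ the property "$H_\theta\notin S$ for all $\theta\in K$" is generic in $\mathcal F_d$, and the families with $H_\theta\notin S$ for all $\theta\in\mathbb R^d$ are dense in $\mathcal F_d$. Say that $d$-parameter families stably reach $S$ if there is a nonempty open subset of $\mathcal F_d$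 every member of which satisfies $H_\theta\in S$ for some $\theta$. Then: 1. For every $d<3$, $d$-parameter families generically avoid $\mathfrak V$; if $N\ge2$, three-parameter families stably reach $\mathfrak V$. (Generically, a three-dimensional perturbation is necessary to reach multiple eigenvalues.) 2. The property of having exactly one double eigenvalue, all other eigenvalues being simple, is generic in $\mathfrak V$. 3. For every $n$ with some $n_k\ge 2$, the set $\mathfrak M_n$ is a nonempty smooth embedded submanifold of $\mathcal H(N)$ of codimension $c(n)$; for every $d<c(n)$, $d$-parameter families generically avoid the closure $\overline{\mathfrak M_n}$ (hence $\mathfrak M_n$), while for every $d\ge c(n)$, $d$-parameter families stably reach $\mathfrak M_n$. If exactly one $n_k$ equals $2$ and all the others equal $1$, then $c(n)=3$, so three parameters suffice; in every other case $c(n)>3$, so more than three parameters are needed. -/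

import Mathlib

open scoped ContDiff Topology

-- Any norm would do: only the topology and the smooth structure it induces are used.
attribute [local instance] Matrix.normedAddCommGroup Matrix.normedSpace

/-- The real vector space of `N × N` complex Hermitian matrices. -/
abbrev HermitianSpace (N : ℕ) : Type :=
  selfAdjoint.submodule ℝ (Matrix (Fin N) (Fin N) ℂ)

/-- The eigenvalues of `H`, each repeated according to its multiplicity. -/
noncomputable def spectrumMultiset {N : ℕ} (H : HermitianSpace N) : Multiset ℂ :=
  (H : Matrix (Fin N) (Fin N) ℂ).charpoly.roots

/-- The multiplicities of the pairwise distinct eigenvalues of `H`. -/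
noncomputable def eigenvalueMultiplicities {N : ℕ} (H : HermitianSpace N) : Multiset ℕ :=
  (spectrumMultiset H).dedup.map fun μ => (spectrumMultiset H).count μ

/-- The Hermitian matrices having at least one multiple eigenvalue. -/
def multipleEigenvalueSet (N : ℕ) : Set (HermitianSpace N) :=
  {H | ∃ μ : ℂ, 2 ≤ (spectrumMultiset H).count μ}

/-- The stratum of Hermitian matrices whose distinct eigenvalues have the multiplicities
`n₁, n₂, …`. The order is disregarded. -/
def multiplicityStratum {N : ℕ} (n : N.Partition) : Set (HermitianSpace N) :=
  {H | eigenvalueMultiplicities H = n.parts}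

/-- The number `(∑ₖ nₖ²) - N̄`, where `N̄` is the number of parts. As all parts are positive, the
subtraction does not truncate. -/
def stratumCodim {N : ℕ} (n : N.Partition) : ℕ :=
  (n.parts.map fun a => a ^ 2).sum - Multiset.card n.parts

/-- At least one of the multiplicities exceeds one. -/
def IsMultipleType {N : ℕ} (n : N.Partition) : Prop :=
  ∃ a ∈ n.parts, 2 ≤ a

/-- Exactly one of the multiplicities is two, and all the others are one. -/
def IsSingleDoubleType {N : ℕ} (n : N.Partition) : Prop :=
  n.parts.count 2 = 1 ∧ ∀ a ∈ n.parts, a ≠ 2 → a = 1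

/-- A smooth embedded submanifold of codimension `c`: locally the zero set of a smooth submersion
to `ℝᶜ`. -/
def IsSubmanifoldOfCodim {E : Type*} [NormedAddCommGroup E] [NormedSpace ℝ E]
    (M : Set E) (c : ℕ) : Prop :=
  ∀ x ∈ M, ∃ U : Set E, IsOpen U ∧ x ∈ U ∧ ∃ F : E → EuclideanSpace ℝ (Fin c),
    ContDiffOn ℝ ∞ F U ∧ (∀ y ∈ U, Function.Surjective (fderiv ℝ F y)) ∧
      M ∩ U = {y ∈ U | F y = 0}

/-- A property is generic if it holds exactly on an open and dense set. -/
def IsGeneric {X : Type*} [TopologicalSpace X] (P : X → Prop) : Prop :=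
  IsOpen {x | P x} ∧ Dense {x | P x}

/-- The space of families of Hermitian matrices depending continuously on `d` real parameters and
starting at `H₀`, with the topology of uniform convergence on compact sets. -/
abbrev PerturbationFamily {N : ℕ} (d : ℕ) (H₀ : HermitianSpace N) : Type :=
  {H : C(EuclideanSpace ℝ (Fin d), HermitianSpace N) // H 0 = H₀}

/-- Generically a `d`-parameter family starting at `H₀` does not reach `S`: avoiding `S` on any
given compact set of parameters is a generic property, and the families that avoid `S` for all
parameters are dense. -/
def GenericallyAvoids {N : ℕ} (d : ℕ) (H₀ : HermitianSpace N) (S : Set (HermitianSpace N)) :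
    Prop :=
  (∀ K : Set (EuclideanSpace ℝ (Fin d)), IsCompact K →
    IsGeneric fun H : PerturbationFamily d H₀ => ∀ θ ∈ K, H.1 θ ∉ S) ∧
  Dense {H : PerturbationFamily d H₀ | ∀ θ, H.1 θ ∉ S}

/-- Some `d`-parameter family starting at `H₀` reaches `S` stably: so do all the families in a
nonempty open set. -/
def StablyReaches {N : ℕ} (d : ℕ) (H₀ : HermitianSpace N) (S : Set (HermitianSpace N)) : Prop :=
  ∃ 𝒰 : Set (PerturbationFamily d H₀), IsOpen 𝒰 ∧ 𝒰.Nonempty ∧ ∀ H ∈ 𝒰, ∃ θ, H.1 θ ∈ S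

/-!
Near a Hermitian matrix `X = W (diagonal l) W*`, every Hermitian matrix can be brought, smoothly and
unitarily, into block diagonal form with respect to the fibres of `l`: the derivative of
`Z ↦ W exp(A Z) (B Z) exp(-A Z) W*`, with `B Z` the block part of `Z` and `A Z` the solution of
`[A, diagonal l] = Z - B Z`, is invertible at `diagonal l` (`exists_local_blockPart`). Close to
`diagonal l`, the spectra of different blocks do not mix, so that eigenvalues of `X` can only split,
and the multiplicities are the same as those of `X` exactly if every block is scalar
(`IsNearBlockDiagonal.stratumCodim_le`, `IsNearBlockDiagonal.eigenvalueType_eq_iff`). The deviation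
of the blocks from scalar matrices takes values in a space of dimension `∑ nₖ² - N̄`, so the strata are
submanifolds of this codimension (`isSubmanifoldOfCodim_multiplicityStratum`), and the codimension is
an upper semicontinuous function of the matrix (`isClosed_setOf_le_stratumCodim`). In particular the
closure of a stratum is covered by strata of at least the same codimension.

A family with fewer parameters than the codimension is made to avoid such a closed union of strata by
first making it smooth and then adding `χ(θ) v`, with `χ` vanishing only at `0`: the bad vectors `v`
form the image under a locally Lipschitz map of a set of Hausdorff dimension less than that of
`HermitianSpace N`, hence a null set (`exists_continuous_avoiding`).

With at least as many parameters, a family containing a transversal slice reaches the stratum stably: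
on the slice, a defining function composed with any nearby family is close to the identity and has a
zero (`exists_zero_of_continuousOn_of_norm_sub_le`). This form of Brouwer's theorem follows from
`not_retraction_sphere`, which is proved by comparing volumes along `x ↦ x + t • h x`.

For genericity in the set of matrices with a multiple eigenvalue: a stratum of matrices with a
multiple eigenvalue has codimension three exactly if there is a single double eigenvalue, and any
coincidence of eigenvalues can be kept while all others are removed by a small perturbation
(`exists_tendsto_stratumCodim_le`).
-/

/-! ### A zero of a small perturbation of the identity -/

section Zero

open MeasureTheory Metric

/-- The value at `1` of a polynomial of degree at most `n` is a linear combination, with universal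
coefficients, of its values at points arbitrarily close to `0`. -/
theorem exists_eval_one_eq_sum (n : ℕ) {τ : ℝ} (hτ : 0 < τ) :
    ∃ c v : Fin (n + 1) → ℝ, (∀ i, 0 ≤ v i ∧ v i ≤ τ) ∧
      ∀ p : Polynomial ℝ, p.natDegree ≤ n → p.eval 1 = ∑ i, c i * p.eval (v i) := by
  set v : Fin (n + 1) → ℝ := fun i => τ * (i / (n + 1)) with hv
  have hinj : Set.InjOn v (Finset.univ : Finset (Fin (n + 1))) := by
    intro i _ j _ hij
    have h : (i : ℝ) / (n + 1) = j / (n + 1) := mul_left_cancel₀ hτ.ne' hij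
    rw [div_left_inj' (by positivity)] at h
    exact Fin.ext (by exact_mod_cast h)
  refine ⟨fun i => (Lagrange.basis Finset.univ v i).eval 1, v, fun i => ⟨by positivity, ?_⟩, ?_⟩
  · have hi : ((i : ℕ) : ℝ) ≤ n + 1 := by exact_mod_cast i.2.le
    exact mul_le_of_le_one_right hτ.le (div_le_one_of_le₀ hi (by positivity))
  · intro p hp
    have hdeg : p.degree < (Finset.univ : Finset (Fin (n + 1))).card := by
      rw [Finset.card_univ, Fintype.card_fin]
      exact (Polynomial.degree_le_of_natDegree_le hp).trans_lt (by exact_mod_cast n.lt_succ_self)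
    conv_lhs => rw [Lagrange.eq_interpolate hinj hdeg]
    rw [Lagrange.interpolate_apply, Polynomial.eval_finsetSum]
    refine Finset.sum_congr rfl fun i _ => ?_
    rw [Polynomial.eval_mul, Polynomial.eval_C, mul_comm]

variable {E : Type*} [NormedAddCommGroup E] [InnerProductSpace ℝ E]

/-- A map that is Lipschitz on a closed ball and vanishes on its boundary stays Lipschitz when it is
extended by zero. -/
theorem LipschitzOnWith.indicator_closedBall [Nontrivial E] {h : E → E} {K : NNReal} {R : ℝ}
    (hR : 0 < R) (hh : LipschitzOnWith K h (closedBall 0 R)) (h0 : ∀ x, ‖x‖ = R → h x = 0) :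
    LipschitzWith K ((closedBall (0 : E) R).indicator h) := by
  have key : ∀ x y : E, ‖x‖ ≤ R → R < ‖y‖ → ‖h x‖ ≤ K * ‖x - y‖ := by
    intro x y hx hy
    obtain ⟨z, hz, hxz⟩ : ∃ z : E, ‖z‖ = R ∧ ‖x - z‖ ≤ ‖y‖ - ‖x‖ := by
      rcases eq_or_ne x 0 with rfl | hx0
      · obtain ⟨z, hz⟩ := exists_norm_eq E hR.le
        exact ⟨z, hz, by simp only [zero_sub, norm_neg, norm_zero, hz]; linarith⟩
      · have hx' : 0 < ‖x‖ := norm_pos_iff.2 hx0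
        refine ⟨(R / ‖x‖) • x, ?_, ?_⟩
        · rw [norm_smul, Real.norm_of_nonneg (by positivity)]; field_simp
        · have : x - (R / ‖x‖) • x = -((R / ‖x‖ - 1) • x) := by rw [sub_smul, one_smul]; abel
          rw [this, norm_neg, norm_smul, Real.norm_of_nonneg]
          · field_simp; linarith
          · rw [sub_nonneg, le_div_iff₀ hx']; linarith
    have h1 := hh.dist_le_mul x (by simpa using hx) z (by simp [hz])
    rw [h0 z hz, dist_zero_right, dist_eq_norm] at h1
    refine h1.trans (mul_le_mul_of_nonneg_left (hxz.trans ?_) K.2)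
    rw [norm_sub_rev]; exact norm_sub_norm_le _ _
  refine LipschitzWith.of_dist_le_mul fun x y => ?_
  by_cases hx : ‖x‖ ≤ R <;> by_cases hy : ‖y‖ ≤ R
  · rw [Set.indicator_of_mem (by simpa using hx), Set.indicator_of_mem (by simpa using hy)]
    exact hh.dist_le_mul x (by simpa using hx) y (by simpa using hy)
  · rw [Set.indicator_of_mem (by simpa using hx), Set.indicator_of_notMem (by simpa using hy),
      dist_zero_right, dist_eq_norm]
    exact key x y hx (not_le.1 hy)
  · rw [Set.indicator_of_notMem (by simpa using hx), Set.indicator_of_mem (by simpa using hy),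
      dist_zero_left, dist_comm, dist_eq_norm]
    exact key y x hy (not_le.1 hx)
  · rw [Set.indicator_of_notMem (by simpa using hx), Set.indicator_of_notMem (by simpa using hy)]
    simp only [dist_self]; positivity

variable [FiniteDimensional ℝ E]

theorem exists_polynomial_eval_eq_det (A : E →L[ℝ] E) :
    ∃ p : Polynomial ℝ, p.natDegree ≤ Module.finrank ℝ E ∧
      ∀ t : ℝ, p.eval t = (ContinuousLinearMap.id ℝ E + t • A).det := by
  classical
  set b := Module.finBasis ℝ E
  set M := LinearMap.toMatrix b b (A : E →ₗ[ℝ] E) with hM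
  refine ⟨_, (Polynomial.natDegree_det_X_add_C_le M 1).trans (by simp), fun t => ?_⟩
  rw [ContinuousLinearMap.det, ← LinearMap.det_toMatrix b, ← Polynomial.coe_evalRingHom,
    RingHom.map_det]
  congr 1
  ext i j
  simp [hM, Matrix.one_apply, apply_ite, Finsupp.single_apply, eq_comm, add_comm,
    LinearMap.toMatrix_apply]
  ring

theorem bijective_add_smul_of_lipschitzWith {g : E → E} {K : NNReal} (hg : LipschitzWith K g)
    {t : ℝ} (ht : |t| * K < 1) : Function.Bijective fun x => x + t • g x := by
  have hc : ∀ y : E, ContractingWith (‖t‖₊ * K) fun x => y - t • g x := fun y =>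
    ⟨by rw [← NNReal.coe_lt_coe]; simpa using ht, LipschitzWith.of_dist_le_mul fun a b => by
      rw [dist_sub_left, dist_smul₀, NNReal.coe_mul, mul_assoc]
      exact mul_le_mul_of_nonneg_left (hg.dist_le_mul a b) (norm_nonneg t)⟩
  refine ⟨fun a b hab => ?_, fun y => ?_⟩
  · simp only at hab
    refine (hc (a + t • g a)).fixedPoint_unique' ?_ ?_
    · change a + t • g a - t • g a = a; simp
    · change a + t • g a - t • g b = b; simp [hab]
  · refine ⟨_, (?_ : ContractingWith.fixedPoint _ (hc y) + _ = y)⟩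
    have := (hc y).fixedPoint_isFixedPt
    rw [Function.IsFixedPt, sub_eq_iff_eq_add] at this
    exact this.symm

theorem image_eq_self_of_bijective {α : Type*} {φ : α → α} (hφ : Function.Bijective φ) {s : Set α}
    (h : ∀ x ∉ s, φ x = x) : φ '' s = s := by
  ext y
  constructor
  · rintro ⟨x, hx, rfl⟩
    by_contra hy
    exact hy ((hφ.1 (h _ hy)).symm ▸ hx)
  · intro hy
    obtain ⟨x, rfl⟩ := hφ.2 y
    by_contra hx
    have : x ∉ s := fun hx' => hx ⟨x, hx', rfl⟩
    exact this (h x this ▸ hy)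

variable [MeasurableSpace E] [BorelSpace E]

/-- There is no `C¹` retraction `x ↦ x + h x` of a ball to its boundary sphere. The maps
`x ↦ x + t • h x` permute the ball for small `t ≥ 0`, so that the polynomial
`t ↦ ∫ det (1 + t • h')` is constant; at `t = 1` the integrand vanishes identically. -/
theorem not_retraction_sphere [Nontrivial E] {h : E → E} {R : ℝ} (hR : 0 < R)
    (hh : ContDiff ℝ 1 h)
    (h0 : ∀ x, ‖x‖ = R → h x = 0) (h1 : ∀ x, ‖x‖ ≤ R → ‖x + h x‖ = R) : False := by
  have hd : Continuous (fderiv ℝ h) := hh.continuous_fderiv one_ne_zero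
  have hdiff : ∀ x, HasFDerivAt h (fderiv ℝ h x) x := fun x =>
    (hh.differentiable one_ne_zero x).hasFDerivAt
  obtain ⟨C, hC⟩ := (isCompact_closedBall (0 : E) R).exists_bound_of_continuousOn hd.continuousOn
  set K : NNReal := C.toNNReal with hK
  have hC' : ∀ x ∈ closedBall (0 : E) R, ‖fderiv ℝ h x‖ ≤ K := fun x hx =>
    (hC x hx).trans (Real.le_coe_toNNReal C)
  have hlip : LipschitzOnWith K h (closedBall 0 R) :=
    (convex_closedBall _ _).lipschitzOnWith_of_nnnorm_fderiv_le
      (fun x _ => hh.differentiable one_ne_zero x) fun x hx => by exact_mod_cast hC' x hx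
  have hg := hlip.indicator_closedBall hR h0
  obtain ⟨δ, hδ, hdet⟩ : ∃ δ > 0, ∀ A : E →L[ℝ] E, ‖A‖ < δ →
      0 < (ContinuousLinearMap.id ℝ E + A).det := by
    have hc : Continuous fun A : E →L[ℝ] E => (ContinuousLinearMap.id ℝ E + A).det :=
      ContinuousLinearMap.continuous_det.comp (continuous_const.add continuous_id)
    have : {A : E →L[ℝ] E | 0 < (ContinuousLinearMap.id ℝ E + A).det} ∈ 𝓝 0 :=
      (isOpen_lt continuous_const hc).mem_nhds (by simp [ContinuousLinearMap.det])
    obtain ⟨δ, hδ, hs⟩ := Metric.mem_nhds_iff.1 this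
    exact ⟨δ, hδ, fun A hA => hs (by simpa using hA)⟩
  set τ : ℝ := min 1 δ / (K + 2) with hτ
  have hτ0 : 0 < τ := by positivity
  have hτK : τ * (K + 2) = min 1 δ := by rw [hτ]; field_simp
  have small : ∀ t, 0 ≤ t → t ≤ τ → t * K < 1 ∧ t * K < δ := by
    intro t ht htτ
    have : t * K < min 1 δ := by
      rw [← hτK]
      have := mul_le_mul_of_nonneg_right htτ K.coe_nonneg
      rw [mul_add]
      exact this.trans_lt (by linarith)
    exact lt_min_iff.1 this
  -- extended by the identity, `x ↦ x + t • h x` is a bijection of `E`, so it permutes the ball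
  have vol : ∀ t, 0 ≤ t → t ≤ τ →
      ∫ x in ball (0 : E) R, (ContinuousLinearMap.id ℝ E + t • fderiv ℝ h x).det =
        (volume (ball (0 : E) R)).toReal := by
    intro t ht htτ
    obtain ⟨ht1, ht2⟩ := small t ht htτ
    have hbij := bijective_add_smul_of_lipschitzWith hg (t := t) (by rwa [abs_of_nonneg ht])
    have hout : ∀ x ∉ ball (0 : E) R, x + t • (closedBall (0 : E) R).indicator h x = x := by
      intro x hx
      by_cases hx' : x ∈ closedBall (0 : E) R
      · have : ‖x‖ = R := le_antisymm (by simpa using hx') (by simpa using hx)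
        simp [Set.indicator_of_mem hx', h0 x this]
      · simp [Set.indicator_of_notMem hx']
    have heq : Set.EqOn (fun x => x + t • h x)
        (fun x => x + t • (closedBall (0 : E) R).indicator h x) (ball 0 R) := fun x hx => by
      simp [Set.indicator_of_mem (ball_subset_closedBall hx)]
    have himg : (fun x => x + t • h x) '' ball 0 R = ball 0 R := by
      rw [heq.image_eq, image_eq_self_of_bijective hbij hout]
    have hinj : Set.InjOn (fun x => x + t • h x) (ball 0 R) :=
      (hbij.1.injOn).congr heq.symm
    have := integral_image_eq_integral_abs_det_fderiv_smul volume (measurableSet_ball)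
      (fun x _ => (((hasFDerivAt_id x).add ((hdiff x).const_smul t)).hasFDerivWithinAt :
        HasFDerivWithinAt (fun x => x + t • h x) _ (ball (0 : E) R) x)) hinj (fun _ => (1 : ℝ))
    rw [show id + t • h = fun x => x + t • h x from rfl, himg] at this
    simp only [smul_eq_mul, mul_one, integral_const, measureReal_restrict_apply_univ] at this
    rw [← measureReal_def, this]
    refine setIntegral_congr_fun measurableSet_ball fun x hx => (abs_of_pos (hdet _ ?_)).symm
    rw [norm_smul, Real.norm_of_nonneg ht]
    exact (mul_le_mul_of_nonneg_left (hC' x (ball_subset_closedBall hx)) ht).trans_lt ht2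
  obtain ⟨c, v, hv, hcv⟩ := exists_eval_one_eq_sum (Module.finrank ℝ E) hτ0
  have hc1 : ∑ i, c i = 1 := by simpa using (hcv 1 (by simp)).symm
  have hint : ∀ t : ℝ, IntegrableOn
      (fun x => (ContinuousLinearMap.id ℝ E + t • fderiv ℝ h x).det) (ball (0 : E) R) := fun t =>
    ((ContinuousLinearMap.continuous_det.comp
      (continuous_const.add (hd.const_smul t))).continuousOn.integrableOn_compact
        (isCompact_closedBall 0 R)).mono_set ball_subset_closedBall
  have hone : ∫ x in ball (0 : E) R, (ContinuousLinearMap.id ℝ E + (1 : ℝ) • fderiv ℝ h x).det =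
      (volume (ball (0 : E) R)).toReal := by
    have : ∀ x, (ContinuousLinearMap.id ℝ E + (1 : ℝ) • fderiv ℝ h x).det =
        ∑ i, c i * (ContinuousLinearMap.id ℝ E + v i • fderiv ℝ h x).det := fun x => by
      obtain ⟨p, hp, hpe⟩ := exists_polynomial_eval_eq_det (fderiv ℝ h x)
      simp_rw [← hpe]
      exact hcv p hp
    simp_rw [this]
    rw [integral_finsetSum _ fun i _ => (hint (v i)).const_mul (c i)]
    simp_rw [integral_const_mul, vol _ (hv _).1 (hv _).2, ← Finset.sum_mul, hc1, one_mul]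
  -- the derivative maps into the tangent space of the sphere
  have hzero : ∀ x ∈ ball (0 : E) R,
      (ContinuousLinearMap.id ℝ E + (1 : ℝ) • fderiv ℝ h x).det = 0 := by
    intro x hx
    by_contra hne
    have hφ : HasFDerivAt (fun x => x + h x)
        (ContinuousLinearMap.id ℝ E + (1 : ℝ) • fderiv ℝ h x) x := by
      rw [one_smul]; exact (hasFDerivAt_id x).add (hdiff x)
    have hconst : HasFDerivAt (fun x => ‖x + h x‖ ^ 2) (0 : E →L[ℝ] ℝ) x := by
      refine (hasFDerivAt_const (R ^ 2) x).congr_of_eventuallyEq ?_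
      filter_upwards [isOpen_ball.mem_nhds hx] with y hy
      rw [h1 y (by simpa using (ball_subset_closedBall hy))]
    have h2 := hφ.norm_sq.unique hconst
    obtain ⟨w, hw⟩ := (LinearMap.equivOfDetNeZero _ hne).surjective (x + h x)
    have hw' : (ContinuousLinearMap.id ℝ E + (1 : ℝ) • fderiv ℝ h x) w = x + h x := hw
    have h4 : 2 • inner ℝ (x + h x) ((ContinuousLinearMap.id ℝ E + (1 : ℝ) • fderiv ℝ h x) w) = 0 :=
      DFunLike.congr_fun h2 w
    rw [hw', real_inner_self_eq_norm_sq, h1 x (by simpa using (ball_subset_closedBall hx))] at h4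
    simp [hR.ne'] at h4
  rw [setIntegral_congr_fun measurableSet_ball hzero, integral_zero] at hone
  exact (ENNReal.toReal_pos (measure_ball_pos volume (0 : E) hR).ne' measure_ball_lt_top.ne).ne hone

/-- A form of Brouwer's fixed point theorem: a continuous map that is close enough to the identity on
a ball has a zero there. Otherwise it could be deformed to a smooth map without zeros that is the
identity near the boundary, and normalizing that map would retract the ball to the sphere. -/
theorem exists_zero_of_continuous_of_norm_sub_le {f : E → E} (hf : Continuous f) {R : ℝ} (hR : 0 < R)
    (hfR : ∀ x, ‖x‖ ≤ R → ‖f x - x‖ ≤ R / 4) : ∃ x, ‖x‖ ≤ R ∧ f x = 0 := by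
  rcases subsingleton_or_nontrivial E with hE | hE
  · exact ⟨0, by simpa using hR.le, Subsingleton.elim _ _⟩
  by_contra! hne
  obtain ⟨m, hm, hmf⟩ : ∃ m > 0, ∀ x, ‖x‖ ≤ R → m ≤ ‖f x‖ := by
    obtain ⟨x₀, hx₀, hmin⟩ := (isCompact_closedBall (0 : E) R).exists_isMinOn
      (nonempty_closedBall.2 hR.le) hf.norm.continuousOn
    exact ⟨‖f x₀‖, norm_pos_iff.2 (hne x₀ (by simpa using hx₀)), fun x hx =>
      hmin (by simpa using hx)⟩
  obtain ⟨g, hg, hgf, -⟩ := (hf.sub continuous_id).exists_contDiff_approx 1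
    (ε := fun _ => min m (R / 4)) continuous_const (fun _ => by positivity)
  simp only [Pi.sub_apply, id, lt_min_iff, dist_eq_norm] at hgf
  let χ : ContDiffBump (0 : E) := ⟨3 / 4 * R, R, by positivity, by linarith⟩
  have hχ1 : ∀ x, ‖x‖ ≤ 3 / 4 * R → χ x = 1 := fun x hx =>
    χ.one_of_mem_closedBall (by simpa using hx)
  have hχ0 : ∀ x, R ≤ ‖x‖ → χ x = 0 := fun x hx => χ.zero_of_le_dist (by simpa using hx)
  set F : E → E := fun x => x + χ x • g x with hF
  have hFd : ContDiff ℝ 1 F := contDiff_id.add ((χ.contDiff (n := 1)).smul hg)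
  have hF0 : ∀ x, F x ≠ 0 := by
    intro x hx
    rcases le_total R ‖x‖ with hxR | hxR
    · rw [hF] at hx
      simp only [hχ0 x hxR, zero_smul, add_zero] at hx
      rw [hx, norm_zero] at hxR
      linarith
    · have h1 : ‖x‖ ≤ ‖g x‖ := by
        conv_lhs =>
          rw [eq_neg_of_add_eq_zero_left hx, norm_neg, norm_smul, Real.norm_of_nonneg χ.nonneg]
        exact mul_le_of_le_one_left (norm_nonneg (g x)) χ.le_one
      have h2 : ‖g x‖ ≤ ‖g x - (f x - x)‖ + ‖f x - x‖ := by
        simpa using norm_add_le (g x - (f x - x)) (f x - x)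
      have h3 := (hgf x).2
      have h4 := hfR x hxR
      rw [hF] at hx
      simp only [hχ1 x (by linarith), one_smul] at hx
      have h5 : ‖g x - (f x - x)‖ = ‖f x‖ := by
        rw [show g x - (f x - x) = (x + g x) - f x by abel, hx, zero_sub, norm_neg]
      have := (hgf x).1
      have := hmf x hxR
      linarith
  have hh : ContDiff ℝ 1 fun x => (R / ‖F x‖) • F x - x :=
    (((contDiff_const).div (hFd.norm ℝ hF0) fun x => norm_ne_zero_iff.2 (hF0 x)).smul hFd).sub
      contDiff_id
  refine not_retraction_sphere hR hh (fun x hx => ?_) fun x _ => ?_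
  · simp only [hF, hχ0 x hx.ge, zero_smul, add_zero, hx, div_self hR.ne', one_smul, sub_self]
  · have : 0 < ‖F x‖ := norm_pos_iff.2 (hF0 x)
    rw [add_sub_cancel, norm_smul, Real.norm_of_nonneg (by positivity)]
    field_simp

theorem exists_zero_of_continuousOn_of_norm_sub_le {f : E → E} {R : ℝ} (hR : 0 < R)
    (hf : ContinuousOn f (closedBall 0 R)) (hfR : ∀ x, ‖x‖ ≤ R → ‖f x - x‖ ≤ R / 4) :
    ∃ x, ‖x‖ ≤ R ∧ f x = 0 := by
  set p : E → E := fun x => (R / max R ‖x‖) • x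
  have hpos : ∀ x : E, 0 < max R ‖x‖ := fun x => lt_max_of_lt_left hR
  have hp : Continuous p :=
    (continuous_const.div (continuous_const.max continuous_norm) fun x => (hpos x).ne').smul
      continuous_id
  have hpR : ∀ x, p x ∈ closedBall (0 : E) R := fun x => by
    rw [mem_closedBall_zero_iff, norm_smul, Real.norm_of_nonneg (div_pos hR (hpos x)).le,
      div_mul_eq_mul_div, div_le_iff₀ (hpos x)]
    exact mul_le_mul_of_nonneg_left (le_max_right _ _) hR.le
  have hpx : ∀ x, ‖x‖ ≤ R → p x = x := fun x hx => by
    simp only [p, max_eq_left hx, div_self hR.ne', one_smul]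
  obtain ⟨x, hx, hfx⟩ := exists_zero_of_continuous_of_norm_sub_le (hf.comp_continuous hp hpR) hR
    fun x hx => by rw [Function.comp_apply, hpx x hx]; exact hfR x hx
  exact ⟨x, hx, by rwa [Function.comp_apply, hpx x hx] at hfx⟩

end Zero

/-! ### Families avoiding submanifolds of large codimension -/

section Avoid

open Module

variable {E P : Type*} [NormedAddCommGroup E] [NormedSpace ℝ E] [FiniteDimensional ℝ E]
  [NormedAddCommGroup P] [NormedSpace ℝ P] [FiniteDimensional ℝ P]

/-- The derivative of a local defining function of a submanifold is surjective, which bounds the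
codimension. -/
theorem IsSubmanifoldOfCodim.le_finrank {M : Set E} {c : ℕ} (hM : IsSubmanifoldOfCodim M c)
    (hne : M.Nonempty) : c ≤ finrank ℝ E := by
  obtain ⟨x, hx⟩ := hne
  obtain ⟨U, -, hxU, F, -, hF', -⟩ := hM x hx
  simpa using LinearMap.finrank_le_finrank_of_surjective (f := (fderiv ℝ F x).toLinearMap)
    (hF' x hxU)

/-- Locally, a submanifold is a Lipschitz image of a piece of the kernel of the derivative of a
defining function. -/
theorem IsSubmanifoldOfCodim.dimH_prod_le {M : Set E} {c : ℕ} (hM : IsSubmanifoldOfCodim M c)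
    (s : Set P) {k : ℕ} (hk : finrank ℝ P + finrank ℝ E ≤ c + k) : dimH (s ×ˢ M) ≤ k := by
  by_contra! hlt
  obtain ⟨⟨p, x⟩, ⟨-, hx⟩, hnhds⟩ := exists_mem_nhdsWithin_lt_dimH_of_lt_dimH hlt
  obtain ⟨U, hUo, hxU, F, hF, hF', hMU⟩ := hM x hx
  have hstrict : HasStrictFDerivAt F (fderiv ℝ F x) x :=
    (hF.contDiffAt (hUo.mem_nhds hxU)).hasStrictFDerivAt (by simp)
  have hrange : (fderiv ℝ F x).range = ⊤ := LinearMap.range_eq_top.2 (hF' x hxU)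
  have hFx : ∀ y ∈ M ∩ U, F y = 0 := fun y hy => by rw [hMU] at hy; exact hy.2
  obtain ⟨K, t, ht, hlip⟩ := (hstrict.to_implicitFunction hrange).exists_lipschitzOnWith
  set Φ := hstrict.implicitToOpenPartialHomeomorph F _ hrange
  set σ := hstrict.implicitFunction F _ hrange (F x)
  have hΦ : ∀ᶠ y in 𝓝 x, (Φ y).2 ∈ t := by
    have h1 : Filter.Tendsto (fun y => (Φ y).2) (𝓝 x) (𝓝 (Φ x).2) :=
      continuous_snd.continuousAt.comp
        (Φ.continuousAt (hstrict.mem_implicitToOpenPartialHomeomorph_source hrange))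
    rw [hstrict.implicitToOpenPartialHomeomorph_self hrange] at h1
    exact h1 ht
  have hW : ∀ᶠ y in 𝓝 x, y ∈ U ∧ (Φ y).2 ∈ t ∧
      hstrict.implicitFunction F _ hrange (F y) (Φ y).2 = y :=
    (hUo.eventually_mem hxU).and (hΦ.and (hstrict.eq_implicitFunction hrange))
  obtain ⟨W, hW, hWx⟩ : ∃ W ∈ 𝓝 x, W ∩ M ⊆ σ '' t := ⟨_, hW, fun y hy =>
    ⟨(Φ y).2, hy.1.2.1, by
      rw [← hy.1.2.2]
      simp only [σ, hFx y ⟨hy.2, hy.1.1⟩, hFx x ⟨hx, hxU⟩]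
      conv_rhs => rw [← hy.1.2.2, hFx y ⟨hy.2, hy.1.1⟩]⟩⟩
  have hsub : (Set.univ ×ˢ W) ∩ (s ×ˢ M) ⊆ (Prod.map id σ) '' ((Set.univ : Set P) ×ˢ t) := by
    rintro ⟨q, y⟩ ⟨⟨-, hyW⟩, -, hyM⟩
    obtain ⟨z, hz, rfl⟩ := hWx ⟨hyW, hyM⟩
    exact ⟨(q, z), ⟨trivial, hz⟩, rfl⟩
  have hL : LipschitzOnWith (max 1 K) (Prod.map (id : P → P) σ) (Set.univ ×ˢ t) := by
    have h1 : LipschitzOnWith 1 (fun p : P × (fderiv ℝ F x).ker => p.1) (Set.univ ×ˢ t) :=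
      LipschitzWith.prod_fst.lipschitzOnWith
    have h2 : LipschitzOnWith (K * 1) (fun p : P × (fderiv ℝ F x).ker => σ p.2)
        (Set.univ ×ˢ t) :=
      hlip.comp LipschitzWith.prod_snd.lipschitzOnWith fun p hp => hp.2
    rw [mul_one] at h2
    exact h1.prodMk h2
  have hdim : dimH ((Set.univ : Set P) ×ˢ t) ≤ k := by
    refine (dimH_mono (Set.subset_univ _)).trans ?_
    rw [Real.dimH_univ_eq_finrank]
    have h1 := LinearMap.finrank_range_add_finrank_ker (fderiv ℝ F x).toLinearMap
    rw [LinearMap.range_eq_top.2 (hF' x hxU), finrank_top, finrank_euclideanSpace_fin] at h1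
    rw [finrank_prod]
    exact_mod_cast (show finrank ℝ P + finrank ℝ (fderiv ℝ F x).ker ≤ k by
      omega)
  refine (hnhds ((Set.univ ×ˢ W) ∩ (s ×ˢ M)) ?_).not_ge
    ((dimH_mono hsub).trans (hL.dimH_image_le.trans hdim))
  exact Filter.inter_mem (mem_nhdsWithin_of_mem_nhds (prod_mem_nhds Filter.univ_mem hW))
    self_mem_nhdsWithin

open MeasureTheory in
/-- If the number of parameters is less than the codimension of `M`, then the translations `v` for
which `G + χ • v` meets `M` form a null set, being the image of a set of smaller dimension. -/
theorem IsSubmanifoldOfCodim.hausdorffMeasure_setOf_exists_mem_eq_zero [MeasurableSpace E] [BorelSpace E]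
    {M : Set E} {c : ℕ}
    (hM : IsSubmanifoldOfCodim M c) (hc : finrank ℝ P < c) {G : P → E} (hG : ContDiff ℝ 1 G)
    {χ : P → ℝ} (hχ : ContDiff ℝ 1 χ) :
    μH[finrank ℝ E] {v : E | ∃ p, χ p ≠ 0 ∧ G p + χ p • v ∈ M} = 0 := by
  rcases M.eq_empty_or_nonempty with rfl | hne
  · simp
  have hcE := hM.le_finrank hne
  set s : Set P := {p | χ p ≠ 0}
  set f : P × E → E := fun q => (χ q.1)⁻¹ • (q.2 - G q.1)
  have hsub : {v : E | ∃ p, χ p ≠ 0 ∧ G p + χ p • v ∈ M} ⊆ f '' (s ×ˢ M) := by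
    rintro v ⟨p, hp, hv⟩
    exact ⟨(p, _), ⟨hp, hv⟩, by simp [f, smul_smul, inv_mul_cancel₀ hp]⟩
  have hlip : ∀ q ∈ s ×ˢ M, ∃ C, ∃ t ∈ 𝓝[s ×ˢ M] q, LipschitzOnWith C f t := by
    rintro q ⟨hq, -⟩
    have hf : ContDiffAt ℝ 1 f q :=
      ((hχ.contDiffAt.comp q contDiffAt_fst).inv hq).smul
        (contDiffAt_snd.sub (hG.contDiffAt.comp q contDiffAt_fst))
    obtain ⟨C, t, ht, hl⟩ := (hf.hasStrictFDerivAt one_ne_zero).exists_lipschitzOnWith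
    exact ⟨C, t, mem_nhdsWithin_of_mem_nhds ht, hl⟩
  have hdim : dimH {v : E | ∃ p, χ p ≠ 0 ∧ G p + χ p • v ∈ M} < (finrank ℝ E : NNReal) := by
    refine ((dimH_mono hsub).trans ((dimH_image_le_of_locally_lipschitzOn hlip).trans
      (hM.dimH_prod_le s (k := finrank ℝ P + finrank ℝ E - c) (by omega)))).trans_lt ?_
    exact_mod_cast (show finrank ℝ P + finrank ℝ E - c < finrank ℝ E by omega)
  simpa using hausdorffMeasure_of_dimH_lt hdim

/-- A continuous family with values in `E` has arbitrarily close continuous families with the same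
initial point that avoid a closed set covered by countably many submanifolds whose codimensions
exceed the number of parameters. -/
theorem exists_continuous_avoiding {S : Set E} {ι : Type*} [Countable ι] {M : ι → Set E}
    {c : ι → ℕ} (hM : ∀ i, IsSubmanifoldOfCodim (M i) (c i)) (hS : S ⊆ ⋃ i, M i)
    {d : ℕ} (hc : ∀ i, d < c i) {H : EuclideanSpace ℝ (Fin d) → E} (hH : Continuous H)
    (hH0 : H 0 ∉ S) {ε : ℝ} (hε : 0 < ε) :
    ∃ H' : EuclideanSpace ℝ (Fin d) → E, Continuous H' ∧ H' 0 = H 0 ∧ (∀ θ, H' θ ∉ S) ∧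
      ∀ θ, dist (H' θ) (H θ) ≤ ε := by
  borelize E
  obtain ⟨G, hG, hGH, -⟩ := hH.exists_contDiff_approx 1 (ε := fun _ => ε / 4) continuous_const
    (fun _ => by positivity)
  set G' : EuclideanSpace ℝ (Fin d) → E := fun θ => G θ + (H 0 - G 0)
  have hG' : ContDiff ℝ 1 G' := hG.add contDiff_const
  -- the weight keeps the initial point fixed and is nonzero for all other parameters
  set χ : EuclideanSpace ℝ (Fin d) → ℝ := fun θ => ‖θ‖ ^ 2 / (1 + ‖θ‖ ^ 2)
  have hχ : ContDiff ℝ 1 χ :=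
    (contDiff_norm_sq ℝ).div (contDiff_const.add (contDiff_norm_sq ℝ)) fun θ => by positivity
  have hχ1 : ∀ θ, ‖χ θ‖ ≤ 1 := fun θ => by
    rw [Real.norm_of_nonneg (by positivity)]
    exact div_le_one_of_le₀ (by linarith) (by positivity)
  have hχ0 : ∀ θ, χ θ = 0 → θ = 0 := fun θ h => by
    have : (1 + ‖θ‖ ^ 2) ≠ 0 := by positivity
    simpa [χ, this] using h
  have hnull : ∀ i, MeasureTheory.Measure.hausdorffMeasure (finrank ℝ E)
      {v : E | ∃ p, χ p ≠ 0 ∧ G' p + χ p • v ∈ M i} = 0 := fun i =>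
    (hM i).hausdorffMeasure_setOf_exists_mem_eq_zero (by simpa using hc i) hG' hχ
  have hdense : Dense {v : E | ∀ i, v ∉ {v : E | ∃ p, χ p ≠ 0 ∧ G' p + χ p • v ∈ M i}} :=
    MeasureTheory.Measure.dense_of_ae (μ := MeasureTheory.Measure.hausdorffMeasure (finrank ℝ E))
      (MeasureTheory.ae_all_iff.2 fun i => MeasureTheory.measure_eq_zero_iff_ae_notMem.1 (hnull i))
  obtain ⟨v, hv, hvε⟩ := hdense.exists_dist_lt 0 (half_pos hε)
  rw [dist_zero_left] at hvε
  refine ⟨fun θ => G' θ + χ θ • v, hG'.continuous.add (hχ.continuous.smul continuous_const),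
    by simp [G', χ], fun θ hθ => ?_, fun θ => ?_⟩
  · rcases eq_or_ne θ 0 with rfl | h0
    · exact hH0 (by simpa [G', χ] using hθ)
    · obtain ⟨i, hi⟩ := Set.mem_iUnion.1 (hS hθ)
      exact hv i ⟨θ, fun h => h0 (hχ0 θ h), hi⟩
  · have h1 := (hGH θ).le
    have h2 := (hGH 0).le
    rw [dist_eq_norm] at h1
    rw [dist_comm, dist_eq_norm] at h2
    have h3 : ‖χ θ • v‖ ≤ ε / 2 := by
      rw [norm_smul]
      exact (mul_le_of_le_one_left (norm_nonneg v) (hχ1 θ)).trans hvε.le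
    rw [dist_eq_norm, show G' θ + χ θ • v - H θ = (G θ - H θ) + (H 0 - G 0) + χ θ • v by
      simp only [G']; abel]
    linarith [norm_add₃_le (a := G θ - H θ) (b := H 0 - G 0) (c := χ θ • v)]

end Avoid

/-- Families with few parameters generically avoid a closed set that is covered by submanifolds of
large codimension. -/
theorem genericallyAvoids_of_subset_iUnion {N d : ℕ} {H₀ : HermitianSpace N}
    {S : Set (HermitianSpace N)} (hS : IsClosed S) (hH₀ : H₀ ∉ S) {ι : Type*} [Countable ι]
    {M : ι → Set (HermitianSpace N)} {c : ι → ℕ} (hM : ∀ i, IsSubmanifoldOfCodim (M i) (c i))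
    (hSM : S ⊆ ⋃ i, M i) (hc : ∀ i, d < c i) : GenericallyAvoids d H₀ S := by
  have hdense : Dense {H : PerturbationFamily d H₀ | ∀ θ, H.1 θ ∉ S} := by
    intro H
    have h : ∀ n : ℕ, ∃ H' : PerturbationFamily d H₀, (∀ θ, H'.1 θ ∉ S) ∧
        ∀ θ, dist (H'.1 θ) (H.1 θ) ≤ 1 / ((n : ℝ) + 1) := fun n => by
      obtain ⟨H', h1, h2, h3, h4⟩ := exists_continuous_avoiding hM hSM hc H.1.continuous
        (by rw [H.2]; exact hH₀) (Nat.one_div_pos_of_nat (n := n) (α := ℝ))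
      exact ⟨⟨⟨H', h1⟩, h2.trans H.2⟩, h3, h4⟩
    choose H' hav hdist using h
    refine mem_closure_of_tendsto (f := H') (b := Filter.atTop) ?_ (Filter.Eventually.of_forall hav)
    rw [tendsto_subtype_rng, ContinuousMap.tendsto_iff_forall_isCompact_tendstoUniformlyOn]
    intro K _
    refine Metric.tendstoUniformlyOn_iff.2 fun ε hε => ?_
    filter_upwards [(tendsto_order.1 (tendsto_one_div_add_atTop_nhds_zero_nat (𝕜 := ℝ))).2 ε hε]
      with n hn θ _
    rw [dist_comm]
    exact (hdist n θ).trans_lt hn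
  refine ⟨fun K hK => ⟨?_, hdense.mono fun H (hH : ∀ θ, H.1 θ ∉ S) θ _ => hH θ⟩, hdense⟩
  exact (ContinuousMap.isOpen_setOfPred_mapsTo hK hS.isOpen_compl).preimage continuous_subtype_val

/-! ### Families stably reaching a submanifold -/

section Reach

/-- Near one of its points, a submanifold of codimension `c` has an affine `c`-dimensional
transversal slice, on which a defining function is close to the identity. -/
theorem IsSubmanifoldOfCodim.exists_slice {E : Type*} [NormedAddCommGroup E] [NormedSpace ℝ E]
    {M : Set E} {c : ℕ} (hM : IsSubmanifoldOfCodim M c) {x : E} (hx : x ∈ M) :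
    ∃ U : Set E, IsOpen U ∧ ∃ F : E → EuclideanSpace ℝ (Fin c), ContinuousOn F U ∧
      (∀ y ∈ U, F y = 0 → y ∈ M) ∧ ∃ R : EuclideanSpace ℝ (Fin c) →L[ℝ] E,
      ∀ᶠ ρ in 𝓝[>] (0 : ℝ), ∀ y, ‖y‖ ≤ ρ → x + R y ∈ U ∧ ‖F (x + R y) - y‖ < ρ / 4 := by
  obtain ⟨U, hUo, hxU, F, hF, hF', hMU⟩ := hM x hx
  have hx0 : F x = 0 := ((Set.ext_iff.1 hMU x).1 ⟨hx, hxU⟩).2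
  obtain ⟨R, hR⟩ := LinearMap.exists_rightInverse_of_surjective (fderiv ℝ F x).toLinearMap
    (LinearMap.range_eq_top.2 (hF' x hxU))
  refine ⟨U, hUo, F, hF.continuousOn, fun y hy h => ((Set.ext_iff.1 hMU y).2 ⟨hy, h⟩).1,
    LinearMap.toContinuousLinearMap R, ?_⟩
  have hd : HasFDerivAt (fun y => F (x + LinearMap.toContinuousLinearMap R y))
      (ContinuousLinearMap.id ℝ (EuclideanSpace ℝ (Fin c))) 0 := by
    have h1 : HasFDerivAt F (fderiv ℝ F x) (x + LinearMap.toContinuousLinearMap R 0) := by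
      rw [map_zero, add_zero]
      exact ((hF.contDiffAt (hUo.mem_nhds hxU)).differentiableAt (by simp)).hasFDerivAt
    convert! h1.comp (0 : EuclideanSpace ℝ (Fin c))
      ((LinearMap.toContinuousLinearMap R).hasFDerivAt.const_add x) using 1
    ext1 y
    exact (DFunLike.congr_fun hR y).symm
  have hev := (hasFDerivAt_iff_isLittleO_nhds_zero.1 hd).bound (show (0 : ℝ) < 1 / 8 by norm_num)
  have hcont : Continuous fun y => x + LinearMap.toContinuousLinearMap R y := by fun_prop
  have hU : ∀ᶠ y in 𝓝 (0 : EuclideanSpace ℝ (Fin c)), x + LinearMap.toContinuousLinearMap R y ∈ U :=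
    hcont.continuousAt.eventually_mem (by simpa using hUo.mem_nhds hxU)
  obtain ⟨r, hr, hball⟩ := Metric.eventually_nhds_iff_ball.1 (hU.and hev)
  filter_upwards [Ioo_mem_nhdsGT hr] with ρ hρ y hy
  obtain ⟨h1, h2⟩ := hball y (by simpa using hy.trans_lt hρ.2)
  refine ⟨h1, ?_⟩
  simp only [zero_add, map_zero, add_zero, hx0, sub_zero, ContinuousLinearMap.id_apply] at h2
  linarith [hρ.1]

theorem exists_leftInverse_euclideanSpace {c d : ℕ} (h : c ≤ d) :
    ∃ (j : EuclideanSpace ℝ (Fin c) →L[ℝ] EuclideanSpace ℝ (Fin d))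
      (π : EuclideanSpace ℝ (Fin d) →L[ℝ] EuclideanSpace ℝ (Fin c)), ∀ y, π (j y) = y := by
  set π : EuclideanSpace ℝ (Fin d) →ₗ[ℝ] EuclideanSpace ℝ (Fin c) :=
    (WithLp.linearEquiv 2 ℝ (Fin c → ℝ)).symm.toLinearMap ∘ₗ
      LinearMap.funLeft ℝ ℝ (Fin.castLE h) ∘ₗ (WithLp.linearEquiv 2 ℝ (Fin d → ℝ)).toLinearMap
  have hsurj : Function.Surjective π :=
    (WithLp.linearEquiv 2 ℝ (Fin c → ℝ)).symm.surjective.comp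
      ((LinearMap.funLeft_surjective_of_injective ℝ ℝ _ (Fin.castLE_injective h)).comp
        (WithLp.linearEquiv 2 ℝ (Fin d → ℝ)).surjective)
  obtain ⟨j, hj⟩ := LinearMap.exists_rightInverse_of_surjective π (LinearMap.range_eq_top.2 hsurj)
  exact ⟨LinearMap.toContinuousLinearMap j, LinearMap.toContinuousLinearMap π,
    fun y => DFunLike.congr_fun hj y⟩

/-- The family is the transversal slice on a ball that does not contain the parameter `0`. For all
families nearby, composing with a defining function gives a map close to the identity of the slice,
which must have a zero. -/
theorem IsSubmanifoldOfCodim.stablyReaches {N : ℕ} {M : Set (HermitianSpace N)} {c : ℕ}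
    (hM : IsSubmanifoldOfCodim M c) (hne : M.Nonempty) {d : ℕ} (hcd : c ≤ d) (hd : 0 < d)
    (H₀ : HermitianSpace N) : StablyReaches d H₀ M := by
  obtain ⟨x, hx⟩ := hne
  obtain ⟨U, hUo, F, hF, hFM, R, hR⟩ := hM.exists_slice hx
  obtain ⟨j, π, hπj⟩ := exists_leftInverse_euclideanSpace hcd
  have hj : ∀ᶠ ρ in 𝓝[>] (0 : ℝ), ∀ y, ‖y‖ ≤ ρ → ‖j y‖ ≤ 1 := by
    have h1 : ∀ᶠ y in 𝓝 (0 : EuclideanSpace ℝ (Fin c)), ‖j y‖ < 1 :=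
      (j.continuous.norm.tendsto' 0 0 (by simp)).eventually_lt_const one_pos
    obtain ⟨r, hr, hball⟩ := Metric.eventually_nhds_iff_ball.1 h1
    filter_upwards [Ioo_mem_nhdsGT hr] with ρ hρ y hy
    exact (hball y (by simpa using hy.trans_lt hρ.2)).le
  obtain ⟨ρ, ⟨hR, hj⟩, hρ : 0 < ρ⟩ := ((hR.and hj).and self_mem_nhdsWithin).exists
  have : Nonempty (Fin d) := ⟨⟨0, hd⟩⟩
  obtain ⟨θ₀, hθ₀⟩ := exists_norm_eq (EuclideanSpace ℝ (Fin d)) (show (0 : ℝ) ≤ 2 by norm_num)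
  set L : EuclideanSpace ℝ (Fin d) → HermitianSpace N := fun θ => x + R (π (θ - θ₀))
  have hL : Continuous L := by fun_prop
  -- the correction term pins the family at `0` and vanishes for `1 ≤ ‖θ‖`, hence around `θ₀`
  set H : C(EuclideanSpace ℝ (Fin d), HermitianSpace N) :=
    ⟨fun θ => L θ + max 0 (1 - ‖θ‖) • (H₀ - L 0), by fun_prop⟩
  have hH0 : H 0 = H₀ := by simp [H]
  have hHj : ∀ y, ‖y‖ ≤ ρ → H (θ₀ + j y) = x + R y := by
    intro y hy
    have h1 : 1 ≤ ‖θ₀ + j y‖ := by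
      have := norm_sub_le (θ₀ + j y) (j y)
      rw [add_sub_cancel_right, hθ₀] at this
      linarith [hj y hy]
    simp [H, L, max_eq_left (sub_nonpos.2 h1), hπj]
  set e : C(EuclideanSpace ℝ (Fin c), EuclideanSpace ℝ (Fin d)) :=
    ⟨fun y => θ₀ + j y, by fun_prop⟩
  -- an open set of pairs, so that the families mapping the compact ball into it form an open set
  set O : Set (EuclideanSpace ℝ (Fin c) × HermitianSpace N) :=
    {p | p.2 ∈ U ∧ ‖F p.2 - p.1‖ < ρ / 4}
  have hO : IsOpen O := by
    have h1 : ContinuousOn (fun p : EuclideanSpace ℝ (Fin c) × HermitianSpace N => ‖F p.2 - p.1‖)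
        (Prod.snd ⁻¹' U) :=
      ((hF.comp continuousOn_snd fun p hp => hp).sub continuousOn_fst).norm
    exact h1.isOpen_inter_preimage (hUo.preimage continuous_snd) isOpen_Iio
  refine ⟨{G | Set.MapsTo ((ContinuousMap.id _).prodMk (G.1.comp e)) (Metric.closedBall 0 ρ) O},
    ?_, ⟨⟨H, hH0⟩, ?_⟩, ?_⟩
  · refine (ContinuousMap.isOpen_setOfPred_mapsTo (isCompact_closedBall 0 ρ) hO).preimage ?_
    refine ContinuousMap.continuous_of_continuous_uncurry _ ?_
    change Continuous fun p : PerturbationFamily d H₀ × EuclideanSpace ℝ (Fin c) =>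
      (p.2, p.1.1 (e p.2))
    exact continuous_snd.prodMk (ContinuousEval.continuous_eval.comp
      ((continuous_subtype_val.comp continuous_fst).prodMk (e.continuous.comp continuous_snd)))
  · intro y hy
    have hy' : ‖y‖ ≤ ρ := by simpa using hy
    change H (θ₀ + j y) ∈ U ∧ ‖F (H (θ₀ + j y)) - y‖ < ρ / 4
    rw [hHj y hy']
    exact hR y hy'
  · intro G hG
    have hG' : ∀ y, ‖y‖ ≤ ρ → G.1 (θ₀ + j y) ∈ U ∧ ‖F (G.1 (θ₀ + j y)) - y‖ < ρ / 4 :=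
      fun y hy => hG (by simpa using hy)
    obtain ⟨y, hy, hy0⟩ := exists_zero_of_continuousOn_of_norm_sub_le
      (f := fun y => F (G.1 (θ₀ + j y))) hρ
      (hF.comp (G.1.continuous.comp e.continuous).continuousOn fun y hy => (hG' y (by simpa using hy)).1)
      fun y hy => (hG' y hy).2.le
    exact ⟨_, hFM _ (hG' y hy).1 hy0⟩

theorem StablyReaches.mono {N d : ℕ} {H₀ : HermitianSpace N} {S T : Set (HermitianSpace N)}
    (h : StablyReaches d H₀ S) (hST : S ⊆ T) : StablyReaches d H₀ T :=
  let ⟨𝒰, h1, h2, h3⟩ := h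
  ⟨𝒰, h1, h2, fun H hH => (h3 H hH).imp fun _ hθ => hST hθ⟩

end Reach

/-! ### Smooth unitary block diagonalization -/

section LocalInverse

theorem exists_contDiffOn_local_inverse {E : Type*} [NormedAddCommGroup E] [NormedSpace ℝ E]
    [CompleteSpace E] {Ψ : E → E} (hΨ : ContDiff ℝ ∞ Ψ) {z : E} {e : E ≃L[ℝ] E}
    (he : HasFDerivAt Ψ (e : E →L[ℝ] E) z) {δ : ℝ} (hδ : 0 < δ) :
    ∃ U : Set E, IsOpen U ∧ Ψ z ∈ U ∧ ∃ Θ : E → E, ContDiffOn ℝ ∞ Θ U ∧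
      ∀ y ∈ U, Function.Surjective (fderiv ℝ Θ y) ∧ Ψ (Θ y) = y ∧ dist (Θ y) z < δ := by
  set f := hΨ.contDiffAt.toOpenPartialHomeomorph Ψ he (by simp)
  have hz : z ∈ f.source := hΨ.contDiffAt.mem_toOpenPartialHomeomorph_source he (by simp)
  have hf : ∀ x, f x = Ψ x := fun x => rfl
  have hcont : Continuous (fderiv ℝ Ψ) := hΨ.continuous_fderiv (by simp)
  have hfd : ∀ x, HasFDerivAt Ψ (fderiv ℝ Ψ x) x := fun x =>
    (hΨ.differentiable (by simp) x).hasFDerivAt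
  set V : Set E := Metric.ball z δ ∩
    fderiv ℝ Ψ ⁻¹' Set.range ((↑) : (E ≃L[ℝ] E) → E →L[ℝ] E)
  have hV : IsOpen V := Metric.isOpen_ball.inter (ContinuousLinearEquiv.isOpen.preimage hcont)
  refine ⟨f.target ∩ f.symm ⁻¹' V, f.isOpen_inter_preimage_symm hV, ?_, f.symm, ?_, ?_⟩
  · refine ⟨f.map_source hz, ?_⟩
    change f.symm (f z) ∈ V
    rw [f.left_inv hz]
    exact ⟨Metric.mem_ball_self hδ, e, he.fderiv.symm⟩
  · rintro y ⟨hy, -, e', he'⟩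
    refine (f.contDiffAt_symm hy (f₀' := e') ?_ hΨ.contDiffAt).contDiffWithinAt
    rw [he']
    exact hfd _
  · rintro y ⟨hy, hyδ, e', he'⟩
    have h1 : HasFDerivAt f (e' : E →L[ℝ] E) (f.symm y) := by rw [he']; exact hfd _
    refine ⟨?_, (hf _).symm.trans (f.right_inv hy), hyδ⟩
    rw [(f.hasFDerivAt_symm hy h1).fderiv]
    exact e'.symm.surjective

open NormedSpace in
/-- Up to a linear map `P`, elements near `P (B z)` are unitarily equivalent to elements `B w`, where
`w` depends smoothly on the given element: the derivative of `w ↦ P (exp (A w) * B w * exp (-A w))`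
at `z` is invertible. -/
theorem exists_local_unitary_normalForm {E 𝔸 : Type*} [NormedAddCommGroup E] [NormedSpace ℝ E]
    [CompleteSpace E] [NormedRing 𝔸] [NormedAlgebra ℝ 𝔸] [CompleteSpace 𝔸] [StarRing 𝔸]
    [ContinuousStar 𝔸] (A B : E →L[ℝ] 𝔸) (P : 𝔸 →L[ℝ] E) {z : E} (hAz : A z = 0)
    (hA : ∀ w, star (A w) = -A w) (e : E ≃L[ℝ] E)
    (he : ∀ w, P (A w * B z - B z * A w + B w) = e w) {δ : ℝ} (hδ : 0 < δ) :
    ∃ U : Set E, IsOpen U ∧ P (B z) ∈ U ∧ ∃ Θ : E → E, ContDiffOn ℝ ∞ Θ U ∧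
      ∀ y ∈ U, Function.Surjective (fderiv ℝ Θ y) ∧ dist (Θ y) z < δ ∧
        ∃ u ∈ unitary 𝔸, P (u * B (Θ y) * star u) = y := by
  set Ψ : E → E := fun w => P (exp (A w) * B w * exp (-A w))
  have hexp : ContDiff ℝ ∞ (exp : 𝔸 → 𝔸) :=
    contDiff_iff_contDiffAt.2 fun x => (exp_analytic (𝕂 := ℝ) x).contDiffAt
  have hΨ : ContDiff ℝ ∞ Ψ := P.contDiff.comp
    (((hexp.comp A.contDiff).mul B.contDiff).mul (hexp.comp A.contDiff.neg))
  have hΨz : Ψ z = P (B z) := by simp [Ψ, hAz]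
  have h0 : HasFDerivAt (exp : 𝔸 → 𝔸) (1 : 𝔸 →L[ℝ] 𝔸) (A z) := by
    rw [hAz]; exact hasFDerivAt_exp_zero
  have h0' : HasFDerivAt (exp : 𝔸 → 𝔸) (1 : 𝔸 →L[ℝ] 𝔸) (-A z) := by
    rw [hAz, neg_zero]; exact hasFDerivAt_exp_zero
  have h1 : HasFDerivAt (fun w => exp (A w)) ((1 : 𝔸 →L[ℝ] 𝔸).comp A) z := h0.comp z A.hasFDerivAt
  have h2 : HasFDerivAt (fun w => exp (-A w)) ((1 : 𝔸 →L[ℝ] 𝔸).comp (-A)) z :=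
    h0'.comp z A.hasFDerivAt.neg
  have h3 : HasFDerivAt Ψ (e : E →L[ℝ] E) z := by
    convert! P.hasFDerivAt.comp z ((h1.mul' B.hasFDerivAt).mul' h2) using 1
    ext w
    rw [ContinuousLinearEquiv.coe_coe, ← he w]
    simp [hAz]
    abel
  obtain ⟨U, hU, hzU, Θ, hΘ, hy⟩ := exists_contDiffOn_local_inverse hΨ h3 hδ
  refine ⟨U, hU, hΨz ▸ hzU, Θ, hΘ, fun y hyU => ?_⟩
  obtain ⟨h4, h5, h6⟩ := hy y hyU
  refine ⟨h4, h6, exp (A (Θ y)), ?_, ?_⟩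
  · let _ : NormedAlgebra ℚ 𝔸 := NormedAlgebra.restrictScalars ℚ ℝ 𝔸
    exact exp_mem_unitary_of_mem_skewAdjoint (skewAdjoint.mem_iff.2 (hA _))
  · rw [star_exp, hA]
    exact h5

end LocalInverse

section Hermitian

open Matrix

variable {N : ℕ}

theorem HermitianSpace.star_coe (Z : HermitianSpace N) :
    star (Z : Matrix (Fin N) (Fin N) ℂ) = Z := Z.2

theorem HermitianSpace.star_apply (Z : HermitianSpace N) (i j : Fin N) :
    star ((Z : Matrix (Fin N) (Fin N) ℂ) i j) = (Z : Matrix (Fin N) (Fin N) ℂ) j i :=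
  congrFun (congrFun (HermitianSpace.star_coe Z) j) i

/-- The diagonal matrix with the given real entries. -/
noncomputable def diagonalHermitian (l : Fin N → ℝ) : HermitianSpace N :=
  ⟨diagonal fun i => (l i : ℂ), by
    change star (diagonal fun i => (l i : ℂ)) = _
    rw [star_eq_conjTranspose, diagonal_conjTranspose]
    congr 1
    ext i
    simp⟩

/-- The entries of a Hermitian matrix whose two indices carry the same value of `l`. -/
noncomputable def blockPart (l : Fin N → ℝ) : HermitianSpace N →ₗ[ℝ] HermitianSpace N where
  toFun Z := ⟨of fun i j => if l i = l j then (Z : Matrix (Fin N) (Fin N) ℂ) i j else 0, by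
    change star (of fun i j => if l i = l j then (Z : Matrix (Fin N) (Fin N) ℂ) i j else 0) = _
    ext i j
    simp only [star_apply, of_apply, eq_comm (a := l j)]
    split_ifs
    · exact Z.star_apply j i
    · exact star_zero _⟩
  map_add' Z W := by ext i j; by_cases h : l i = l j <;> simp [h]
  map_smul' r Z := by ext i j; by_cases h : l i = l j <;> simp [h]

/-- The solution of `[A, diagonal l] = Z - blockPart l Z` with vanishing block part. -/
noncomputable def offBlockGenerator (l : Fin N → ℝ) :
    HermitianSpace N →ₗ[ℝ] Matrix (Fin N) (Fin N) ℂ where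
  toFun Z := of fun i j => if l i = l j then 0 else
    (Z : Matrix (Fin N) (Fin N) ℂ) i j / ((l j - l i : ℝ) : ℂ)
  map_add' Z W := by ext i j; by_cases h : l i = l j <;> simp [h, add_div]
  map_smul' r Z := by ext i j; by_cases h : l i = l j <;> simp [h, mul_div_assoc]

theorem blockPart_apply (l : Fin N → ℝ) (Z : HermitianSpace N) (i j : Fin N) :
    (blockPart l Z : Matrix (Fin N) (Fin N) ℂ) i j =
      if l i = l j then (Z : Matrix (Fin N) (Fin N) ℂ) i j else 0 := rfl

theorem offBlockGenerator_apply (l : Fin N → ℝ) (Z : HermitianSpace N) (i j : Fin N) :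
    offBlockGenerator l Z i j = if l i = l j then 0 else
      (Z : Matrix (Fin N) (Fin N) ℂ) i j / ((l j - l i : ℝ) : ℂ) := rfl

theorem star_offBlockGenerator (l : Fin N → ℝ) (Z : HermitianSpace N) :
    star (offBlockGenerator l Z) = -offBlockGenerator l Z := by
  ext i j
  rw [Matrix.neg_apply, Matrix.star_apply, offBlockGenerator_apply, offBlockGenerator_apply]
  by_cases h : l i = l j
  · simp [h]
  · rw [if_neg h, if_neg (Ne.symm h), star_div₀, Z.star_apply, Complex.star_def, Complex.conj_ofReal,
      ← neg_sub (l i) (l j), Complex.ofReal_neg, div_neg, neg_neg]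

theorem blockPart_diagonalHermitian (l : Fin N → ℝ) :
    blockPart l (diagonalHermitian l) = diagonalHermitian l := by
  ext i j
  rw [blockPart_apply]
  rcases eq_or_ne i j with rfl | h <;> simp [diagonalHermitian, *]

theorem offBlockGenerator_diagonalHermitian (l : Fin N → ℝ) :
    offBlockGenerator l (diagonalHermitian l) = 0 := by
  ext i j
  rcases eq_or_ne i j with rfl | h <;> simp [offBlockGenerator, diagonalHermitian, *]

theorem offBlockGenerator_commutator (l : Fin N → ℝ) (Z : HermitianSpace N) :
    offBlockGenerator l Z * (diagonalHermitian l : Matrix (Fin N) (Fin N) ℂ) -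
      (diagonalHermitian l : Matrix (Fin N) (Fin N) ℂ) * offBlockGenerator l Z +
        (blockPart l Z : Matrix (Fin N) (Fin N) ℂ) = Z := by
  ext i j
  rw [Matrix.add_apply, Matrix.sub_apply, diagonalHermitian, mul_diagonal, diagonal_mul,
    blockPart_apply, offBlockGenerator_apply]
  by_cases h : l i = l j
  · simp [h]
  · rw [if_neg h, if_neg h]
    have : ((l j - l i : ℝ) : ℂ) ≠ 0 := by
      exact_mod_cast sub_ne_zero.2 (Ne.symm h)
    field_simp
    push_cast
    ring

/-- Conjugation by a unitary matrix. -/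
def conjHermitian (W : unitary (Matrix (Fin N) (Fin N) ℂ)) :
    HermitianSpace N ≃ₗ[ℝ] HermitianSpace N where
  toFun Z := ⟨W * Z * star (W : Matrix (Fin N) (Fin N) ℂ), by
    change star _ = _
    rw [star_mul, star_mul, star_star, Z.star_coe, mul_assoc]⟩
  invFun Z := ⟨star (W : Matrix (Fin N) (Fin N) ℂ) * Z * W, by
    change star _ = _
    rw [star_mul, star_mul, star_star, Z.star_coe, mul_assoc]⟩
  map_add' Z Y := by ext1; simp [mul_add, add_mul]
  map_smul' r Z := by ext1; simp
  left_inv Z := by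
    ext1
    calc star (W : Matrix (Fin N) (Fin N) ℂ) * (W * Z * star (W : Matrix (Fin N) (Fin N) ℂ)) * W
        = (star (W : Matrix (Fin N) (Fin N) ℂ) * W) * Z *
            (star (W : Matrix (Fin N) (Fin N) ℂ) * W) := by simp only [mul_assoc]
      _ = Z := by simp
  right_inv Z := by
    ext1
    calc (W : Matrix (Fin N) (Fin N) ℂ) * (star (W : Matrix (Fin N) (Fin N) ℂ) * Z * W) *
          star (W : Matrix (Fin N) (Fin N) ℂ)
        = (W * star (W : Matrix (Fin N) (Fin N) ℂ)) * Z *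
            (W * star (W : Matrix (Fin N) (Fin N) ℂ)) := by simp only [mul_assoc]
      _ = Z := by simp

theorem coe_conjHermitian (W : unitary (Matrix (Fin N) (Fin N) ℂ)) (Z : HermitianSpace N) :
    (conjHermitian W Z : Matrix (Fin N) (Fin N) ℂ) =
      W * Z * star (W : Matrix (Fin N) (Fin N) ℂ) := rfl

theorem spectrumMultiset_conjHermitian (W : unitary (Matrix (Fin N) (Fin N) ℂ))
    (Z : HermitianSpace N) : spectrumMultiset (conjHermitian W Z) = spectrumMultiset Z := by
  rw [spectrumMultiset, coe_conjHermitian, mul_assoc, charpoly_mul_comm, mul_assoc,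
    Unitary.coe_star_mul_self, mul_one]
  rfl

theorem spectrumMultiset_diagonalHermitian (l : Fin N → ℝ) :
    spectrumMultiset (diagonalHermitian l) =
      Finset.univ.val.map fun i => (l i : ℂ) := by
  rw [spectrumMultiset, diagonalHermitian, charpoly_diagonal, Polynomial.roots_prod]
  · simp
  · simp [Finset.prod_ne_zero_iff, Polynomial.X_sub_C_ne_zero]

theorem exists_eq_conjHermitian_diagonalHermitian (X : HermitianSpace N) :
    ∃ (W : unitary (Matrix (Fin N) (Fin N) ℂ)) (l : Fin N → ℝ),
      X = conjHermitian W (diagonalHermitian l) := by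
  have hX : (X : Matrix (Fin N) (Fin N) ℂ).IsHermitian := X.star_coe
  refine ⟨hX.eigenvectorUnitary, hX.eigenvalues, Subtype.ext ?_⟩
  rw [coe_conjHermitian]
  conv_lhs => rw [hX.spectral_theorem, Unitary.conjStarAlgAut_apply]
  rfl

/-- Near a Hermitian matrix `X` with eigenvalues `l`, every Hermitian matrix has the spectrum of a
matrix that is block diagonal with respect to `l` and close to `diagonal l`; this matrix can be
chosen to depend smoothly on the given one, the off-block part of `Θ` parametrizing the eigenspaces. -/
theorem exists_local_blockPart (X : HermitianSpace N) :
    ∃ l : Fin N → ℝ, spectrumMultiset X = spectrumMultiset (diagonalHermitian l) ∧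
      ∀ δ > 0, ∃ U : Set (HermitianSpace N), IsOpen U ∧ X ∈ U ∧
        ∃ Θ : HermitianSpace N → HermitianSpace N, ContDiffOn ℝ ∞ Θ U ∧
          ∀ y ∈ U, Function.Surjective (fderiv ℝ Θ y) ∧ dist (Θ y) (diagonalHermitian l) < δ ∧
            spectrumMultiset y = spectrumMultiset (blockPart l (Θ y)) := by
  obtain ⟨W, l, rfl⟩ := exists_eq_conjHermitian_diagonalHermitian X
  refine ⟨l, spectrumMultiset_conjHermitian _ _, fun δ hδ => ?_⟩
  let φ := (Matrix.toEuclideanCLM (n := Fin N) (𝕜 := ℂ))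
  let φl : Matrix (Fin N) (Fin N) ℂ ≃ₗ[ℝ] (EuclideanSpace ℂ (Fin N) →L[ℂ] EuclideanSpace ℂ (Fin N)) :=
    (φ.toAlgEquiv.toLinearEquiv).restrictScalars ℝ
  have : FiniteDimensional ℝ (EuclideanSpace ℂ (Fin N) →L[ℂ] EuclideanSpace ℂ (Fin N)) :=
    LinearEquiv.finiteDimensional φl
  let P : Matrix (Fin N) (Fin N) ℂ →ₗ[ℝ] HermitianSpace N :=
    (conjHermitian W).toLinearMap ∘ₗ selfAdjointPart ℝ
  have hP : ∀ Z : HermitianSpace N, P (Z : Matrix (Fin N) (Fin N) ℂ) = conjHermitian W Z := by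
    intro Z
    change conjHermitian W (selfAdjointPart ℝ (Z : Matrix (Fin N) (Fin N) ℂ)) = _
    congr 1
    exact IsSelfAdjoint.selfAdjointPart_apply ℝ Z.2
  obtain ⟨U, hU, hXU, Θ, hΘ, h⟩ := exists_local_unitary_normalForm
    (LinearMap.toContinuousLinearMap (φl.toLinearMap ∘ₗ offBlockGenerator l))
    (LinearMap.toContinuousLinearMap
      (φl.toLinearMap ∘ₗ (selfAdjoint.submodule ℝ _).subtype ∘ₗ blockPart l))
    (LinearMap.toContinuousLinearMap (P ∘ₗ φl.symm.toLinearMap)) (z := diagonalHermitian l)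
    (by
      change φl (offBlockGenerator l (diagonalHermitian l)) = 0
      rw [offBlockGenerator_diagonalHermitian, map_zero])
    (fun w => by
      change star (φ (offBlockGenerator l w)) = -φ (offBlockGenerator l w)
      rw [← map_star, star_offBlockGenerator, map_neg])
    ((conjHermitian W).toContinuousLinearEquiv)
    (fun w => by
      change P (φ.symm (φ _ * φ (blockPart l (diagonalHermitian l)).1 -
        φ (blockPart l (diagonalHermitian l)).1 * φ _ + φ (blockPart l w).1)) = conjHermitian W w
      rw [← map_mul, ← map_mul, ← map_sub, ← map_add, StarAlgEquiv.symm_apply_apply,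
        blockPart_diagonalHermitian, offBlockGenerator_commutator, hP])
    hδ
  refine ⟨U, hU, ?_, Θ, hΘ, fun y hy => ?_⟩
  · convert! hXU using 1
    change _ = P (φ.symm (φ (blockPart l (diagonalHermitian l)).1))
    rw [StarAlgEquiv.symm_apply_apply, hP, blockPart_diagonalHermitian]
  · obtain ⟨h1, h2, u, hu, huy⟩ := h y hy
    refine ⟨h1, h2, ?_⟩
    obtain ⟨v, rfl⟩ : ∃ v, φ v = u := φ.surjective u
    have hv : v ∈ unitary (Matrix (Fin N) (Fin N) ℂ) := by
      rw [Unitary.mem_iff, ← map_star, ← map_mul, ← map_mul, ← map_one φ] at hu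
      exact ⟨φ.injective hu.1, φ.injective hu.2⟩
    have h3 : P (φ.symm (φ v * φ (blockPart l (Θ y)).1 * star (φ v))) = y := huy
    rw [← map_star, ← map_mul, ← map_mul, StarAlgEquiv.symm_apply_apply] at h3
    have h4 : P (conjHermitian ⟨v, hv⟩ (blockPart l (Θ y))).1 = y := h3
    rw [hP] at h4
    rw [← h4, spectrumMultiset_conjHermitian, spectrumMultiset_conjHermitian, h4]

end Hermitian

/-! ### Multiplicities as cardinalities of fibres -/

section Fibers

open Finset

variable {ι α β : Type*} [Fintype ι] [DecidableEq α] [DecidableEq β]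

/-- The cardinalities of the nonempty fibres of a function. -/
def fiberCards (f : ι → α) : Multiset ℕ :=
  (univ.image f).val.map fun x => #{i | f i = x}

theorem sum_sq_fiberCards (f : ι → α) :
    ((fiberCards f).map fun a => a ^ 2).sum = #{p : ι × ι | f p.1 = f p.2} := by
  rw [fiberCards, Multiset.map_map, card_eq_sum_card_fiberwise (f := fun p : ι × ι => f p.1)
    (t := univ.image f) (fun p _ => mem_image_of_mem f (mem_univ p.1))]
  refine sum_congr rfl fun x _ => ?_
  rw [Function.comp_apply, sq, ← card_product]
  congr 1
  ext p
  simp only [mem_product, mem_filter, mem_univ, true_and]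
  grind

theorem card_fiberCards (f : ι → α) : Multiset.card (fiberCards f) = #(univ.image f) := by
  rw [fiberCards, Multiset.card_map, card_val]

/-- The cardinalities of the fibres only depend on the partition into fibres. -/
theorem fiberCards_congr {f : ι → α} {g : ι → β} (h : ∀ i j, f i = f j ↔ g i = g j) :
    fiberCards f = fiberCards g := by
  rcases isEmpty_or_nonempty ι with hι | hι
  · simp [fiberCards]
  have hfac : g.FactorsThrough f := fun i j hij => (h i j).1 hij
  set φ : α → β := Function.extend f g fun _ => g hι.some
  have hφ : ∀ i, φ (f i) = g i := fun i => hfac.extend_apply _ i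
  have himg : univ.image g = (univ.image f).image φ := by
    rw [image_image]
    exact image_congr fun i _ => (hφ i).symm
  have hinj : Set.InjOn φ (univ.image f) := by
    intro x hx y hy hxy
    obtain ⟨i, -, rfl⟩ := mem_image.1 (mem_coe.1 hx)
    obtain ⟨j, -, rfl⟩ := mem_image.1 (mem_coe.1 hy)
    rw [hφ, hφ] at hxy
    exact (h i j).2 hxy
  rw [fiberCards, fiberCards, himg, image_val_of_injOn hinj, Multiset.map_map]
  refine Multiset.map_congr rfl fun x hx => ?_
  obtain ⟨i, -, rfl⟩ := mem_image.1 (Finset.mem_def.2 hx)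
  simp only [Function.comp_apply, hφ]
  simp only [h]

theorem fiberCards_eq_of_card_eq {f g : ι → α} (h : ∀ x, #{i | f i = x} = #{i | g i = x}) :
    fiberCards f = fiberCards g := by
  have himg : univ.image f = univ.image g := by
    ext x
    have : (∃ i, f i = x) ↔ ∃ i, g i = x := by
      have h1 : ∀ f : ι → α, (∃ i, f i = x) ↔ 0 < #{i | f i = x} := fun f => by
        simp [card_pos, Finset.Nonempty]
      rw [h1, h1, h]
    simpa using this
  simp only [fiberCards, himg, h]

end Fibers

section Multiplicities

variable {N : ℕ}

theorem eigenvalueMultiplicities_eq_fiberCards {H : HermitianSpace N} {l : Fin N → ℝ}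
    (h : spectrumMultiset H = spectrumMultiset (diagonalHermitian l)) :
    eigenvalueMultiplicities H = fiberCards l := by
  have h1 : eigenvalueMultiplicities H = fiberCards fun i => (l i : ℂ) := by
    rw [eigenvalueMultiplicities, h, spectrumMultiset_diagonalHermitian, fiberCards,
      Finset.image_val]
    refine Multiset.map_congr rfl fun x _ => ?_
    rw [Multiset.count_map]
    simp only [eq_comm (a := x)]
    rfl
  rw [h1]
  exact fiberCards_congr fun i j => Complex.ofReal_inj

theorem exists_spectrumMultiset_eq (H : HermitianSpace N) :
    ∃ l : Fin N → ℝ, spectrumMultiset H = spectrumMultiset (diagonalHermitian l) := by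
  obtain ⟨W, l, rfl⟩ := exists_eq_conjHermitian_diagonalHermitian H
  exact ⟨l, spectrumMultiset_conjHermitian _ _⟩

/-- The partition of `N` formed by the multiplicities of the eigenvalues. -/
noncomputable def eigenvalueType (H : HermitianSpace N) : N.Partition where
  parts := eigenvalueMultiplicities H
  parts_pos {i} hi := by
    obtain ⟨x, hx, rfl⟩ := Multiset.mem_map.1 hi
    exact Multiset.count_pos.2 (Multiset.mem_dedup.1 hx)
  parts_sum := by
    obtain ⟨l, hl⟩ := exists_spectrumMultiset_eq H
    rw [eigenvalueMultiplicities_eq_fiberCards hl]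
    have := Finset.card_eq_sum_card_image l Finset.univ
    rw [Finset.card_univ, Fintype.card_fin] at this
    exact this.symm

theorem mem_multiplicityStratum_iff {H : HermitianSpace N} {n : N.Partition} :
    H ∈ multiplicityStratum n ↔ eigenvalueType H = n := by
  rw [Nat.Partition.ext_iff]
  rfl

theorem stratumCodim_eigenvalueType {H : HermitianSpace N} {l : Fin N → ℝ}
    (h : spectrumMultiset H = spectrumMultiset (diagonalHermitian l)) :
    stratumCodim (eigenvalueType H) =
      Finset.card {p : Fin N × Fin N | l p.1 = l p.2} - Finset.card (Finset.univ.image l) := by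
  have h1 : (eigenvalueType H).parts = fiberCards l := eigenvalueMultiplicities_eq_fiberCards h
  rw [stratumCodim, h1, sum_sq_fiberCards, card_fiberCards]

end Multiplicities

/-! ### Block diagonal matrices close to a diagonal matrix -/

section Near

open Matrix Finset

variable {N : ℕ}

/-- The matrix `B` is block diagonal with respect to the fibres of `l` and within `ε` of
`diagonal l`, where `ε` is small compared to the differences of the values of `l`. -/
structure IsNearBlockDiagonal (l : Fin N → ℝ) (ε : ℝ) (B : HermitianSpace N) : Prop where
  apply_eq_zero : ∀ i j, l i ≠ l j → (B : Matrix (Fin N) (Fin N) ℂ) i j = 0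
  norm_sub_le : ∀ i j, ‖(B : Matrix (Fin N) (Fin N) ℂ) i j - diagonal (fun i => (l i : ℂ)) i j‖ ≤ ε
  gap : ∀ i j, l i ≠ l j → 2 * (N * ε) < |l i - l j|

theorem sum_normSq_row (V : unitary (Matrix (Fin N) (Fin N) ℂ)) (i : Fin N) :
    ∑ a, ‖(V : Matrix (Fin N) (Fin N) ℂ) i a‖ ^ 2 = 1 := by
  have h0 : (V : Matrix (Fin N) (Fin N) ℂ) * star (V : Matrix (Fin N) (Fin N) ℂ) = 1 :=
    Unitary.coe_mul_star_self V
  have h := congrFun (congrFun h0 i) i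
  rw [mul_apply, one_apply_eq] at h
  simp only [Matrix.star_apply, RCLike.star_def, Complex.mul_conj'] at h
  exact_mod_cast h

theorem sum_normSq_col (V : unitary (Matrix (Fin N) (Fin N) ℂ)) (a : Fin N) :
    ∑ i, ‖(V : Matrix (Fin N) (Fin N) ℂ) i a‖ ^ 2 = 1 := by
  have h := congrFun (congrFun (Unitary.coe_star_mul_self V) a) a
  rw [mul_apply, one_apply_eq] at h
  simp only [Matrix.star_apply, RCLike.star_def, Complex.conj_mul'] at h
  exact_mod_cast h

theorem exists_col_ne_zero (V : unitary (Matrix (Fin N) (Fin N) ℂ)) (a : Fin N) :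
    ∃ i, (V : Matrix (Fin N) (Fin N) ℂ) i a ≠ 0 := by
  by_contra! h
  simpa [h] using sum_normSq_col V a

theorem exists_row_ne_zero (V : unitary (Matrix (Fin N) (Fin N) ℂ)) (i : Fin N) :
    ∃ a, (V : Matrix (Fin N) (Fin N) ℂ) i a ≠ 0 := by
  by_contra! h
  simpa [h] using sum_normSq_row V i

variable {l μ : Fin N → ℝ} {ε : ℝ} {V : unitary (Matrix (Fin N) (Fin N) ℂ)}

theorem conj_apply_eq_sum (i j : Fin N) :
    (conjHermitian V (diagonalHermitian μ) : Matrix (Fin N) (Fin N) ℂ) i j =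
      ∑ a, (V : Matrix (Fin N) (Fin N) ℂ) i a * μ a * star ((V : Matrix (Fin N) (Fin N) ℂ) j a) := by
  rw [coe_conjHermitian, mul_apply]
  refine sum_congr rfl fun a _ => ?_
  rw [diagonalHermitian, mul_diagonal]
  rfl

/-- The restriction of an eigenvector to a block is again an eigenvector, so that an eigenvector
lives in blocks whose value of `l` is close to its eigenvalue. The estimate is taken at the largest
entry in the block. -/
theorem IsNearBlockDiagonal.abs_eigenvalue_sub_le
    (hB : IsNearBlockDiagonal l ε (conjHermitian V (diagonalHermitian μ))) {i a : Fin N}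
    (hV : (V : Matrix (Fin N) (Fin N) ℂ) i a ≠ 0) : |μ a - l i| ≤ N * ε := by
  set B : Matrix (Fin N) (Fin N) ℂ := (conjHermitian V (diagonalHermitian μ)).1 with hBdef
  have hBV : ∀ i, ∑ j, B i j * (V : Matrix (Fin N) (Fin N) ℂ) j a =
      (V : Matrix (Fin N) (Fin N) ℂ) i a * μ a := by
    intro i
    have h1 : B * (V : Matrix (Fin N) (Fin N) ℂ) = V * diagonal fun i => (μ i : ℂ) := by
      rw [hBdef, coe_conjHermitian, mul_assoc, Unitary.coe_star_mul_self, mul_one]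
      rfl
    have h2 := congrFun (congrFun h1 i) a
    rwa [mul_apply, mul_diagonal] at h2
  obtain ⟨i₀, hi₀, hmax⟩ := exists_max_image (univ.filter fun j => l j = l i)
    (fun j => ‖(V : Matrix (Fin N) (Fin N) ℂ) j a‖) ⟨i, by simp⟩
  have hli : l i₀ = l i := (mem_filter.1 hi₀).2
  have hpos : 0 < ‖(V : Matrix (Fin N) (Fin N) ℂ) i₀ a‖ :=
    (norm_pos_iff.2 hV).trans_le (hmax i (by simp))
  have hε : 0 ≤ ε := (norm_nonneg _).trans (hB.norm_sub_le i i)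
  have key : (((μ a - l i : ℝ) : ℂ)) * (V : Matrix (Fin N) (Fin N) ℂ) i₀ a =
      ∑ j, (B i₀ j - diagonal (fun i => (l i : ℂ)) i₀ j) * (V : Matrix (Fin N) (Fin N) ℂ) j a := by
    simp only [sub_mul, sum_sub_distrib, hBV, diagonal_apply, ite_mul, zero_mul, sum_ite_eq,
      mem_univ, if_true]
    rw [hli]
    push_cast
    ring
  have h1 : |μ a - l i| * ‖(V : Matrix (Fin N) (Fin N) ℂ) i₀ a‖ ≤
      N * ε * ‖(V : Matrix (Fin N) (Fin N) ℂ) i₀ a‖ := by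
    calc |μ a - l i| * ‖(V : Matrix (Fin N) (Fin N) ℂ) i₀ a‖
        = ‖(((μ a - l i : ℝ) : ℂ)) * (V : Matrix (Fin N) (Fin N) ℂ) i₀ a‖ := by
          rw [norm_mul, Complex.norm_real, Real.norm_eq_abs]
      _ ≤ ∑ _j : Fin N, ε * ‖(V : Matrix (Fin N) (Fin N) ℂ) i₀ a‖ := by
          rw [key]
          refine norm_sum_le_of_le _ fun j _ => ?_
          by_cases hj : l j = l i
          · rw [norm_mul]
            exact mul_le_mul (hB.norm_sub_le i₀ j) (hmax j (by simp [hj])) (norm_nonneg _) hε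
          · have hne : l i₀ ≠ l j := fun h => hj (h.symm.trans hli)
            rw [diagonal_apply_ne _ (fun h => hne (congrArg l h)),
              show B i₀ j = 0 from hB.apply_eq_zero i₀ j hne]
            simp only [sub_zero, zero_mul, norm_zero]
            positivity
      _ = N * ε * ‖(V : Matrix (Fin N) (Fin N) ℂ) i₀ a‖ := by simp [mul_assoc]
  exact le_of_mul_le_mul_right h1 hpos

/-- Each eigenvalue of a matrix close to `diagonal l` is assigned the nearby value of `l`. As the
eigenvectors assigned to a block span it, this assignment respects multiplicities. -/
theorem IsNearBlockDiagonal.exists_assignment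
    (hB : IsNearBlockDiagonal l ε (conjHermitian V (diagonalHermitian μ))) :
    ∃ m : Fin N → ℝ, fiberCards m = fiberCards l ∧ (∀ a b, μ a = μ b → m a = m b) ∧
      ∀ i a, (V : Matrix (Fin N) (Fin N) ℂ) i a ≠ 0 → l i = m a := by
  choose k hk using exists_col_ne_zero V
  have hsep : ∀ i j a b, (V : Matrix (Fin N) (Fin N) ℂ) i a ≠ 0 →
      (V : Matrix (Fin N) (Fin N) ℂ) j b ≠ 0 → μ a = μ b → l i = l j := by
    intro i j a b hi hj hab
    by_contra hne
    have h1 := hB.abs_eigenvalue_sub_le hi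
    have h2 := hB.abs_eigenvalue_sub_le hj
    have h3 := hB.gap i j hne
    rw [hab, abs_sub_comm] at h1
    have h4 := _root_.abs_sub_le (l i) (μ b) (l j)
    linarith
  have hV : ∀ i a, (V : Matrix (Fin N) (Fin N) ℂ) i a ≠ 0 → l i = l (k a) :=
    fun i a h => hsep i (k a) a a h (hk a) rfl
  refine ⟨fun a => l (k a), fiberCards_eq_of_card_eq fun x => ?_,
    fun a b hab => hsep _ _ a b (hk a) (hk b) hab, hV⟩
  have h1 : ∑ i with l i = x, ∑ a, ‖(V : Matrix (Fin N) (Fin N) ℂ) i a‖ ^ 2 =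
      (#{i | l i = x} : ℝ) := by
    simp [sum_normSq_row]
  have h2 : ∑ i with l i = x, ∑ a, ‖(V : Matrix (Fin N) (Fin N) ℂ) i a‖ ^ 2 =
      (#{a | l (k a) = x} : ℝ) := by
    rw [sum_comm, card_filter, Nat.cast_sum]
    refine sum_congr rfl fun a _ => ?_
    rw [sum_filter]
    by_cases ha : l (k a) = x
    · rw [if_pos ha, Nat.cast_one, ← sum_normSq_col V a]
      refine sum_congr rfl fun i _ => ?_
      by_cases hi : (V : Matrix (Fin N) (Fin N) ℂ) i a = 0
      · simp [hi]
      · rw [if_pos ((hV i a hi).trans ha)]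
    · rw [if_neg ha, Nat.cast_zero]
      refine sum_eq_zero fun i _ => ?_
      by_cases hi : (V : Matrix (Fin N) (Fin N) ℂ) i a = 0
      · simp [hi]
      · rw [if_neg fun h => ha ((hV i a hi).symm.trans h)]
  exact_mod_cast h2.symm.trans h1

/-- Under a small perturbation multiple eigenvalues can only split. -/
theorem IsNearBlockDiagonal.stratumCodim_le {B : HermitianSpace N}
    (hB : IsNearBlockDiagonal l ε B) :
    stratumCodim (eigenvalueType B) ≤ stratumCodim (eigenvalueType (diagonalHermitian l)) := by
  obtain ⟨V, μ, rfl⟩ := exists_eq_conjHermitian_diagonalHermitian B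
  obtain ⟨m, hm, hμ, -⟩ := hB.exists_assignment
  rw [stratumCodim_eigenvalueType (spectrumMultiset_conjHermitian _ _),
    stratumCodim_eigenvalueType rfl, ← sum_sq_fiberCards l, ← card_fiberCards l, ← hm,
    sum_sq_fiberCards, card_fiberCards]
  refine tsub_le_tsub (card_le_card fun p hp => ?_) ?_
  · simp only [mem_filter, mem_univ, true_and] at hp ⊢
    exact hμ _ _ hp
  · have hfac : m.FactorsThrough μ := fun a b h => hμ a b h
    have : univ.image m = (univ.image μ).image (Function.extend μ m fun _ => 0) := by
      rw [image_image]
      exact image_congr fun a _ => (hfac.extend_apply _ a).symm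
    rw [this]
    exact card_image_le

/-- The multiplicities survive a small perturbation exactly if no block of the perturbed matrix
splits. -/
theorem IsNearBlockDiagonal.eigenvalueType_eq_iff {B : HermitianSpace N}
    (hB : IsNearBlockDiagonal l ε B) :
    eigenvalueType B = eigenvalueType (diagonalHermitian l) ↔
      (∀ i j, i ≠ j → (B : Matrix (Fin N) (Fin N) ℂ) i j = 0) ∧
        ∀ i j, l i = l j →
          (B : Matrix (Fin N) (Fin N) ℂ) i i = (B : Matrix (Fin N) (Fin N) ℂ) j j := by
  constructor
  · intro h
    obtain ⟨V, μ, rfl⟩ := exists_eq_conjHermitian_diagonalHermitian B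
    obtain ⟨m, hm, hμ, hV⟩ := hB.exists_assignment
    have hpar := congrArg Nat.Partition.parts h
    change eigenvalueMultiplicities _ = eigenvalueMultiplicities _ at hpar
    rw [eigenvalueMultiplicities_eq_fiberCards (spectrumMultiset_conjHermitian _ _),
      eigenvalueMultiplicities_eq_fiberCards rfl, ← hm] at hpar
    have hsub : ({p | μ p.1 = μ p.2} : Finset (Fin N × Fin N)) ⊆
        ({p | m p.1 = m p.2} : Finset (Fin N × Fin N)) := fun p hp => by
      simp only [mem_filter, mem_univ, true_and] at hp ⊢
      exact hμ _ _ hp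
    have heq := eq_of_subset_of_card_le hsub (by
      rw [← sum_sq_fiberCards, ← sum_sq_fiberCards, hpar])
    have hinj : ∀ a b, m a = m b → μ a = μ b := fun a b hab => by
      have : (a, b) ∈ ({p | m p.1 = m p.2} : Finset (Fin N × Fin N)) := by simpa using hab
      rw [← heq] at this
      simpa using this
    have key : ∀ i a, (V : Matrix (Fin N) (Fin N) ℂ) i a ≠ 0 → ∀ j,
        (conjHermitian V (diagonalHermitian μ) : Matrix (Fin N) (Fin N) ℂ) i j =
          μ a * (1 : Matrix (Fin N) (Fin N) ℂ) i j := by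
      intro i a hia j
      rw [conj_apply_eq_sum, ← Unitary.coe_mul_star_self V, mul_apply, mul_sum]
      refine sum_congr rfl fun b _ => ?_
      by_cases hb : (V : Matrix (Fin N) (Fin N) ℂ) i b = 0
      · simp [hb]
      · rw [hinj b a ((hV i b hb).symm.trans (hV i a hia)), Unitary.coe_star, Matrix.star_apply]
        ring
    refine ⟨fun i j hij => ?_, fun i j hij => ?_⟩
    · obtain ⟨a, ha⟩ := exists_row_ne_zero V i
      rw [key i a ha, one_apply_ne hij, mul_zero]
    · obtain ⟨a, ha⟩ := exists_row_ne_zero V i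
      obtain ⟨b, hb⟩ := exists_row_ne_zero V j
      rw [key i a ha, key j b hb, one_apply_eq, one_apply_eq,
        hinj a b (by rw [← hV i a ha, ← hV j b hb, hij])]
  · rintro ⟨hoff, hdiag⟩
    set b : Fin N → ℝ := fun i => ((B : Matrix (Fin N) (Fin N) ℂ) i i).re
    have hbi : ∀ i, (B : Matrix (Fin N) (Fin N) ℂ) i i = b i := fun i =>
      (Complex.conj_eq_iff_re.1 (B.star_apply i i)).symm
    have hBb : B = diagonalHermitian b := by
      ext i j
      rcases eq_or_ne i j with rfl | hij
      · rw [hbi]; simp [diagonalHermitian]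
      · rw [hoff i j hij]; simp [diagonalHermitian, hij]
    have hbl : ∀ i, |b i - l i| ≤ ε := fun i => by
      have := hB.norm_sub_le i i
      rwa [diagonal_apply_eq, hbi, ← Complex.ofReal_sub, Complex.norm_real] at this
    refine Nat.Partition.ext ?_
    change eigenvalueMultiplicities _ = eigenvalueMultiplicities _
    rw [hBb, eigenvalueMultiplicities_eq_fiberCards rfl, eigenvalueMultiplicities_eq_fiberCards rfl]
    refine fiberCards_congr fun i j => ⟨fun h => ?_, fun h => ?_⟩
    · by_contra hne
      have h1 := hbl i
      have h2 := hbl j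
      have h3 := hB.gap i j hne
      have h4 := _root_.abs_sub_le (l i) (b i) (l j)
      rw [abs_sub_comm (l i) (b i), h] at h4
      rw [h] at h1
      have hN : (1 : ℝ) ≤ N := by exact_mod_cast i.pos
      have h5 : ε ≤ N * ε := le_mul_of_one_le_left ((abs_nonneg _).trans h2) hN
      linarith
    · have := hdiag i j h
      rw [hbi, hbi] at this
      exact_mod_cast this

/-- Matrices close enough to `diagonal l` have a block part close to `diagonal l`. -/
theorem exists_isNearBlockDiagonal (l : Fin N → ℝ) :
    ∃ ε > 0, ∀ Z : HermitianSpace N, dist Z (diagonalHermitian l) < ε →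
      IsNearBlockDiagonal l ε (blockPart l Z) := by
  obtain ⟨g, hg, hgap⟩ : ∃ g > 0, ∀ i j, l i ≠ l j → g ≤ |l i - l j| := by
    rcases (univ.filter fun p : Fin N × Fin N => l p.1 ≠ l p.2).eq_empty_or_nonempty with h | h
    · exact ⟨1, one_pos, fun i j hij => by simpa using filter_eq_empty_iff.1 h (mem_univ (i, j)) hij⟩
    · obtain ⟨p, hp, hmin⟩ := exists_min_image _ (fun p => |l p.1 - l p.2|) h
      exact ⟨_, abs_pos.2 (sub_ne_zero.2 (mem_filter.1 hp).2),
        fun i j hij => hmin (i, j) (by simpa using hij)⟩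
  refine ⟨g / (2 * (N + 1)), by positivity, fun Z hZ => ⟨fun i j hij => ?_, fun i j => ?_,
    fun i j hij => ?_⟩⟩
  · rw [blockPart_apply, if_neg hij]
  · rw [blockPart_apply]
    split_ifs with h
    · refine le_trans ?_ hZ.le
      rw [dist_eq_norm]
      exact Matrix.norm_entry_le_entrywise_sup_norm
        (Z - diagonalHermitian l : HermitianSpace N).1 (i := i) (j := j)
    · rw [diagonal_apply_ne _ (fun hij => h (congrArg l hij)), sub_zero, norm_zero]
      positivity
  · refine lt_of_lt_of_le ?_ (hgap i j hij)
    rw [show 2 * (N * (g / (2 * (N + 1)))) = g * (N / (N + 1) : ℝ) by field_simp]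
    exact mul_lt_of_lt_one_right hg (by rw [div_lt_one (by positivity)]; linarith)

end Near

/-! ### The strata as submanifolds -/

section Strata

open Matrix

variable {N : ℕ}

/-- The positions of the entries inside the blocks given by the fibres of `l`, without one diagonal
position in each block, selected by the fixed points of `r`. -/
def blockIndex (l : Fin N → ℝ) (r : Fin N → Fin N) : Set (Fin N × Fin N) :=
  {p | l p.1 = l p.2 ∧ ¬ (p.1 = p.2 ∧ r p.1 = p.1)}

theorem exists_blockRepresentative (l : Fin N → ℝ) :
    ∃ r : Fin N → Fin N, (∀ i, l (r i) = l i) ∧ ∀ i j, l i = l j → r i = r j := by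
  choose g hg using fun x : Set.range l => x.2
  exact ⟨fun i => g ⟨l i, i, rfl⟩, fun i => hg _, fun i j h => by simp only [h]⟩

variable {l : Fin N → ℝ} {r : Fin N → Fin N}

theorem card_blockIndex (hlr : ∀ i, l (r i) = l i) (hr : ∀ i j, l i = l j → r i = r j) :
    Nat.card (blockIndex l r) = stratumCodim (eigenvalueType (diagonalHermitian l)) := by
  classical
  have hI : blockIndex l r = (({p | l p.1 = l p.2} : Finset (Fin N × Fin N)) \
      ({p | p.1 = p.2 ∧ r p.1 = p.1} : Finset (Fin N × Fin N)) : Finset (Fin N × Fin N)) := by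
    ext p
    simp [blockIndex]
  rw [hI, Nat.card_coe_set_eq, Set.ncard_coe_finset, stratumCodim_eigenvalueType rfl,
    Finset.card_sdiff_of_subset]
  · congr 1
    have himg : ({p | p.1 = p.2 ∧ r p.1 = p.1} : Finset (Fin N × Fin N)).image (fun p => l p.1) =
        Finset.univ.image l := by
      ext x
      simp only [Finset.mem_image, Finset.mem_filter, Finset.mem_univ, true_and]
      constructor
      · rintro ⟨p, -, rfl⟩
        exact ⟨p.1, rfl⟩
      · rintro ⟨i, rfl⟩
        exact ⟨(r i, r i), ⟨rfl, hr _ _ (hlr i)⟩, hlr i⟩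
    rw [← himg, Finset.card_image_of_injOn]
    rintro ⟨i, j⟩ hp ⟨i', j'⟩ hq h
    simp only [Finset.coe_filter, Finset.mem_univ, true_and, Set.mem_ofPred_eq] at hp hq h
    obtain ⟨rfl, hi⟩ := hp
    obtain ⟨rfl, hi'⟩ := hq
    rw [← hi, ← hi', hr _ _ h]
  · intro p hp
    simp only [Finset.mem_filter, Finset.mem_univ, true_and] at hp ⊢
    rw [hp.1]

/-- The deviation of the blocks of a Hermitian matrix from scalar matrices. Off the diagonal, the
real numbers `Re Zᵢⱼ + Im Zᵢⱼ` and `Re Zᵢⱼ - Im Zᵢⱼ` at the positions `(i, j)` and `(j, i)` encode the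
complex entry `Zᵢⱼ`; on the diagonal, the selected entry of the block is subtracted. -/
noncomputable def blockDeviation (l : Fin N → ℝ) (r : Fin N → Fin N) :
    HermitianSpace N →ₗ[ℝ] (blockIndex l r → ℝ) where
  toFun Z p := if p.1.1 = p.1.2 then
      ((Z : Matrix (Fin N) (Fin N) ℂ) p.1.1 p.1.1).re -
        ((Z : Matrix (Fin N) (Fin N) ℂ) (r p.1.1) (r p.1.1)).re
    else ((Z : Matrix (Fin N) (Fin N) ℂ) p.1.1 p.1.2).re +
      ((Z : Matrix (Fin N) (Fin N) ℂ) p.1.1 p.1.2).im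
  map_add' Z W := by
    ext p
    simp only [Submodule.coe_add, Matrix.add_apply, Complex.add_re, Complex.add_im, Pi.add_apply]
    split_ifs <;> ring
  map_smul' c Z := by
    ext p
    simp only [Submodule.coe_smul, Matrix.smul_apply, Complex.smul_re, Complex.smul_im,
      Pi.smul_apply, RingHom.id_apply, smul_eq_mul]
    split_ifs <;> ring

theorem blockDeviation_apply (Z : HermitianSpace N) (p : blockIndex l r) :
    blockDeviation l r Z p = if p.1.1 = p.1.2 then
      ((Z : Matrix (Fin N) (Fin N) ℂ) p.1.1 p.1.1).re -
        ((Z : Matrix (Fin N) (Fin N) ℂ) (r p.1.1) (r p.1.1)).re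
    else ((Z : Matrix (Fin N) (Fin N) ℂ) p.1.1 p.1.2).re +
      ((Z : Matrix (Fin N) (Fin N) ℂ) p.1.1 p.1.2).im := rfl

theorem blockDeviation_surjective (hlr : ∀ i, l (r i) = l i) (hr : ∀ i j, l i = l j → r i = r j) :
    Function.Surjective (blockDeviation l r) := by
  classical
  intro t
  set R : Fin N → Fin N → ℝ := fun i j => if h : (i, j) ∈ blockIndex l r then t ⟨(i, j), h⟩ else 0
  refine ⟨⟨of fun i j => if i = j then (R i i : ℂ) else
    ⟨(R i j + R j i) / 2, (R i j - R j i) / 2⟩, ?_⟩, ?_⟩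
  · change star _ = _
    ext i j
    rw [Matrix.star_apply, of_apply, of_apply]
    by_cases h : i = j
    · subst h
      rw [if_pos rfl]
      exact Complex.conj_ofReal _
    · rw [if_neg h, if_neg (Ne.symm h)]
      exact Complex.ext (show (R j i + R i j) / 2 = (R i j + R j i) / 2 by ring)
        (show -((R j i - R i j) / 2) = (R i j - R j i) / 2 by ring)
  · ext ⟨⟨i, j⟩, hp⟩
    rw [blockDeviation_apply]
    have hRt : R i j = t ⟨(i, j), hp⟩ := dif_pos hp
    simp only [of_apply]
    by_cases h : i = j
    · subst h
      have h0 : R (r i) (r i) = 0 := dif_neg fun h => h.2 ⟨rfl, hr _ _ (hlr i)⟩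
      simp only [if_true, Complex.ofReal_re, h0, hRt, sub_zero]
    · simp only [if_neg h, ← hRt]
      ring

theorem blockDeviation_eq_zero_iff (hlr : ∀ i, l (r i) = l i)
    (hr : ∀ i j, l i = l j → r i = r j) (Z : HermitianSpace N) : blockDeviation l r Z = 0 ↔
      (∀ i j, i ≠ j → (blockPart l Z : Matrix (Fin N) (Fin N) ℂ) i j = 0) ∧
      ∀ i j, l i = l j → (blockPart l Z : Matrix (Fin N) (Fin N) ℂ) i i =
        (blockPart l Z : Matrix (Fin N) (Fin N) ℂ) j j := by
  have hre : ∀ i, (((Z : Matrix (Fin N) (Fin N) ℂ) i i).re : ℂ) =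
      (Z : Matrix (Fin N) (Fin N) ℂ) i i := fun i => Complex.conj_eq_iff_re.1 (Z.star_apply i i)
  simp only [blockPart_apply, if_true]
  constructor
  · intro h
    have h' : ∀ i j, (i, j) ∈ blockIndex l r → (if i = j then
        ((Z : Matrix (Fin N) (Fin N) ℂ) i i).re - ((Z : Matrix (Fin N) (Fin N) ℂ) (r i) (r i)).re
        else ((Z : Matrix (Fin N) (Fin N) ℂ) i j).re + ((Z : Matrix (Fin N) (Fin N) ℂ) i j).im) =
          0 := fun i j hp =>
      (blockDeviation_apply Z ⟨(i, j), hp⟩).symm.trans (congrFun h _)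
    refine ⟨fun i j hij => ?_, fun i j hij => ?_⟩
    · split_ifs with hl
      · have h1 := h' i j ⟨hl, fun h => hij h.1⟩
        have h2 := h' j i ⟨hl.symm, fun h => hij h.1.symm⟩
        simp only [if_neg hij, if_neg (Ne.symm hij)] at h1 h2
        rw [← Z.star_apply i j, Complex.star_def, Complex.conj_re, Complex.conj_im] at h2
        apply Complex.ext
        · simp only [Complex.zero_re]; linarith
        · simp only [Complex.zero_im]; linarith
      · rfl
    · have h1 : ∀ i, ((Z : Matrix (Fin N) (Fin N) ℂ) i i).re =
          ((Z : Matrix (Fin N) (Fin N) ℂ) (r i) (r i)).re := by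
        intro i
        by_cases hri : r i = i
        · rw [hri]
        · have := h' i i ⟨rfl, fun h => hri h.2⟩
          simp only [if_true] at this
          linarith
      rw [← hre i, ← hre j, h1 i, h1 j, hr i j hij]
  · rintro ⟨h1, h2⟩
    ext ⟨⟨i, j⟩, hp⟩
    rw [blockDeviation_apply]
    by_cases h : i = j
    · subst h
      simp only [if_true, h2 i (r i) (hlr i).symm, sub_self, Pi.zero_apply]
    · have h3 := h1 i j h
      rw [if_pos hp.1] at h3
      simp [h, h3]

theorem exists_linearMap_eq_zero_iff (l : Fin N → ℝ) :
    ∃ T : HermitianSpace N →ₗ[ℝ]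
        EuclideanSpace ℝ (Fin (stratumCodim (eigenvalueType (diagonalHermitian l)))),
      Function.Surjective T ∧ ∀ Z, T Z = 0 ↔
        (∀ i j, i ≠ j → (blockPart l Z : Matrix (Fin N) (Fin N) ℂ) i j = 0) ∧
        ∀ i j, l i = l j → (blockPart l Z : Matrix (Fin N) (Fin N) ℂ) i i =
          (blockPart l Z : Matrix (Fin N) (Fin N) ℂ) j j := by
  obtain ⟨r, hlr, hr⟩ := exists_blockRepresentative l
  let φ : (blockIndex l r → ℝ) ≃ₗ[ℝ]
      EuclideanSpace ℝ (Fin (stratumCodim (eigenvalueType (diagonalHermitian l)))) :=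
    (LinearEquiv.funCongrLeft ℝ ℝ (Finite.equivFinOfCardEq (card_blockIndex hlr hr)).symm).trans
      (WithLp.linearEquiv 2 ℝ _).symm
  refine ⟨φ.toLinearMap ∘ₗ blockDeviation l r,
    φ.surjective.comp (blockDeviation_surjective hlr hr), fun Z => ?_⟩
  rw [← blockDeviation_eq_zero_iff hlr hr Z]
  exact φ.map_eq_zero_iff

theorem eigenvalueType_congr {Y Z : HermitianSpace N} (h : spectrumMultiset Y = spectrumMultiset Z) :
    eigenvalueType Y = eigenvalueType Z :=
  Nat.Partition.ext (by
    change Multiset.map _ _ = Multiset.map _ _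
    rw [h])

theorem isSubmanifoldOfCodim_multiplicityStratum (n : N.Partition) :
    IsSubmanifoldOfCodim (multiplicityStratum n) (stratumCodim n) := by
  intro X hX
  obtain ⟨l, hXl, hloc⟩ := exists_local_blockPart X
  obtain ⟨ε, hε, hnear⟩ := exists_isNearBlockDiagonal l
  obtain ⟨U, hU, hXU, Θ, hΘ, hΘU⟩ := hloc ε hε
  have hn : n = eigenvalueType (diagonalHermitian l) :=
    (mem_multiplicityStratum_iff.1 hX).symm.trans (eigenvalueType_congr hXl)
  subst hn
  obtain ⟨T, hT, hT0⟩ := exists_linearMap_eq_zero_iff l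
  refine ⟨U, hU, hXU, fun y => LinearMap.toContinuousLinearMap T (Θ y),
    (LinearMap.toContinuousLinearMap T).contDiff.comp_contDiffOn hΘ, fun y hy => ?_, ?_⟩
  · have hd : HasFDerivAt Θ (fderiv ℝ Θ y) y :=
      ((hΘ.contDiffAt (hU.mem_nhds hy)).differentiableAt (by simp)).hasFDerivAt
    have := ((LinearMap.toContinuousLinearMap T).hasFDerivAt.comp y hd).fderiv
    rw [Function.comp_def] at this
    rw [this]
    exact hT.comp (hΘU y hy).1
  · ext y
    refine and_comm.trans (and_congr_right fun hy => ?_)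
    obtain ⟨-, h2, h3⟩ := hΘU y hy
    rw [mem_multiplicityStratum_iff, eigenvalueType_congr h3, (hnear _ h2).eigenvalueType_eq_iff]
    exact (hT0 _).symm

theorem isClosed_setOf_le_stratumCodim (k : ℕ) :
    IsClosed {H : HermitianSpace N | k ≤ stratumCodim (eigenvalueType H)} := by
  rw [← isOpen_compl_iff, isOpen_iff_mem_nhds]
  intro X hX
  obtain ⟨l, hXl, hloc⟩ := exists_local_blockPart X
  obtain ⟨ε, hε, hnear⟩ := exists_isNearBlockDiagonal l
  obtain ⟨U, hU, hXU, Θ, hΘ, hΘU⟩ := hloc ε hε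
  filter_upwards [hU.mem_nhds hXU] with y hy
  obtain ⟨-, h2, h3⟩ := hΘU y hy
  simp only [Set.mem_compl_iff, Set.mem_ofPred_eq, not_le] at hX ⊢
  rw [eigenvalueType_congr h3]
  rw [eigenvalueType_congr hXl] at hX
  exact (hnear _ h2).stratumCodim_le.trans_lt hX

end Strata

/-! ### Codimensions of the multiplicity types -/

section Partitions

variable {N : ℕ}

theorem stratumCodim_eq_sum (n : N.Partition) :
    stratumCodim n = (n.parts.map fun a => a ^ 2 - 1).sum := by
  have key : ∀ s : Multiset ℕ, (∀ a ∈ s, 0 < a) →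
      (s.map fun a => a ^ 2).sum = (s.map fun a => a ^ 2 - 1).sum + Multiset.card s := by
    intro s
    induction s using Multiset.induction_on with
    | empty => simp
    | cons a s ih =>
      intro h
      have ha : 1 ≤ a ^ 2 := Nat.one_le_pow _ _ (h a (Multiset.mem_cons_self a s))
      rw [Multiset.map_cons, Multiset.sum_cons, Multiset.map_cons, Multiset.sum_cons,
        Multiset.card_cons, ih fun b hb => h b (Multiset.mem_cons_of_mem hb)]
      omega
  rw [stratumCodim, key _ fun a ha => n.parts_pos ha, Nat.add_sub_cancel]

theorem IsSingleDoubleType.stratumCodim_eq {n : N.Partition} (h : IsSingleDoubleType n) :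
    stratumCodim n = 3 := by
  obtain ⟨t, ht⟩ := Multiset.exists_cons_of_mem (Multiset.count_pos.1 (h.1.symm ▸ one_pos))
  have h2 : 2 ∉ t := by
    have := h.1
    rw [ht, Multiset.count_cons_self] at this
    exact Multiset.count_eq_zero.1 (by omega)
  have h1 : ∀ a ∈ t, a ^ 2 - 1 = 0 := fun a ha => by
    rw [h.2 a (ht ▸ Multiset.mem_cons_of_mem ha) fun h => h2 (h ▸ ha)]
    rfl
  have h0 : (t.map fun a => a ^ 2 - 1).sum = 0 := by
    refine Multiset.sum_eq_zero fun x hx => ?_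
    obtain ⟨a, ha, rfl⟩ := Multiset.mem_map.1 hx
    exact h1 a ha
  rw [stratumCodim_eq_sum, ht, Multiset.map_cons, Multiset.sum_cons, h0]
  norm_num

theorem IsMultipleType.three_lt_stratumCodim {n : N.Partition} (hn : IsMultipleType n)
    (h : ¬ IsSingleDoubleType n) : 3 < stratumCodim n := by
  obtain ⟨a, ha, ha2⟩ := hn
  obtain ⟨t, ht⟩ := Multiset.exists_cons_of_mem ha
  have hsum : stratumCodim n = (a ^ 2 - 1) + (t.map fun a => a ^ 2 - 1).sum := by
    rw [stratumCodim_eq_sum, ht, Multiset.map_cons, Multiset.sum_cons]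
  rcases ha2.eq_or_lt with rfl | ha3
  · obtain ⟨b, hb, hb2⟩ : ∃ b ∈ t, 2 ≤ b := by
      by_contra! hlt
      refine h ⟨?_, fun b hb hb2 => ?_⟩
      · rw [ht, Multiset.count_cons_self,
          Multiset.count_eq_zero.2 fun h2 => (hlt 2 h2).false]
      · have hb0 := n.parts_pos hb
        rw [ht, Multiset.mem_cons] at hb
        have := hlt b (hb.resolve_left hb2)
        omega
    have h1 : b ^ 2 - 1 ≤ (t.map fun a => a ^ 2 - 1).sum :=
      Multiset.single_le_sum (fun _ _ => Nat.zero_le _) _ (Multiset.mem_map_of_mem _ hb)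
    have h2 : 2 ^ 2 ≤ b ^ 2 := Nat.pow_le_pow_left hb2 2
    omega
  · have h2 : 3 ^ 2 ≤ a ^ 2 := Nat.pow_le_pow_left ha3 2
    omega

theorem IsMultipleType.three_le_stratumCodim {n : N.Partition} (hn : IsMultipleType n) :
    3 ≤ stratumCodim n := by
  by_cases h : IsSingleDoubleType n
  · exact h.stratumCodim_eq.ge
  · exact (hn.three_lt_stratumCodim h).le

theorem isMultipleType_iff_three_le_stratumCodim {n : N.Partition} :
    IsMultipleType n ↔ 3 ≤ stratumCodim n := by
  refine ⟨fun h => h.three_le_stratumCodim, fun h => ?_⟩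
  by_contra hn
  have : stratumCodim n = 0 := by
    rw [stratumCodim_eq_sum]
    refine Multiset.sum_eq_zero fun x hx => ?_
    obtain ⟨a, ha, rfl⟩ := Multiset.mem_map.1 hx
    have h1 : a = 1 := by
      have := n.parts_pos ha
      have : ¬ 2 ≤ a := fun h => hn ⟨a, ha, h⟩
      omega
    simp [h1]
  omega

theorem mem_multipleEigenvalueSet_iff {H : HermitianSpace N} :
    H ∈ multipleEigenvalueSet N ↔ IsMultipleType (eigenvalueType H) := by
  constructor
  · rintro ⟨μ, hμ⟩
    exact ⟨_, Multiset.mem_map_of_mem _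
      (Multiset.mem_dedup.2 (Multiset.count_pos.1 (by omega : 0 < _))), hμ⟩
  · rintro ⟨a, ha, ha2⟩
    obtain ⟨μ, -, rfl⟩ := Multiset.mem_map.1 ha
    exact ⟨μ, ha2⟩

end Partitions

/-! ### Matrices with prescribed multiplicities -/

section Existence

open Finset

variable {N : ℕ}

theorem exists_fiberCards_eq (n : N.Partition) : ∃ l : Fin N → ℝ, fiberCards l = n.parts := by
  set L := n.parts.toList with hL
  have hLn : (L : Multiset ℕ) = n.parts := Multiset.coe_toList _
  have hcard : Fintype.card (Σ k : Fin L.length, Fin (L.get k)) = N := by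
    rw [Fintype.card_sigma]
    simp only [Fintype.card_fin]
    rw [← List.sum_ofFn, List.ofFn_get, ← Multiset.sum_coe, hLn, n.parts_sum]
  let e := Fintype.equivFinOfCardEq hcard
  have hfib : ∀ k : Fin L.length, #{i | (e.symm i).1 = k} = L.get k := by
    intro k
    rw [← Fintype.card_fin (L.get k), ← card_univ]
    refine (card_bij (fun x _ => e ⟨k, x⟩) (fun x _ => by simp) (fun x _ y _ h => ?_)
      fun i hi => ?_).symm
    · simpa using h
    · simp only [mem_filter, mem_univ, true_and] at hi
      subst hi
      exact ⟨(e.symm i).2, mem_univ _, by simp⟩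
  refine ⟨fun i => (((e.symm i).1 : ℕ) : ℝ), ?_⟩
  rw [fiberCards_congr (g := fun i => (e.symm i).1) fun i j => by
    rw [Nat.cast_inj, Fin.val_inj]]
  have himg : univ.image (fun i => (e.symm i).1) = univ := by
    refine eq_univ_iff_forall.2 fun k => ?_
    have hk : 0 < #{i | (e.symm i).1 = k} := by
      rw [hfib]
      exact n.parts_pos (by rw [← hLn]; exact Multiset.mem_coe.2 (List.get_mem L k))
    obtain ⟨i, hi⟩ := card_pos.1 hk
    exact mem_image.2 ⟨i, mem_univ i, (mem_filter.1 hi).2⟩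
  rw [fiberCards, himg]
  simp only [hfib]
  rw [Fin.univ_val_map, ← hLn]
  exact congrArg _ (List.ofFn_get L)

theorem multiplicityStratum_nonempty (n : N.Partition) : (multiplicityStratum n).Nonempty := by
  obtain ⟨l, hl⟩ := exists_fiberCards_eq n
  exact ⟨diagonalHermitian l, (eigenvalueMultiplicities_eq_fiberCards rfl).trans hl⟩

theorem mem_multipleEigenvalueSet_iff_exists {H : HermitianSpace N} {l : Fin N → ℝ}
    (h : spectrumMultiset H = spectrumMultiset (diagonalHermitian l)) :
    H ∈ multipleEigenvalueSet N ↔ ∃ i j, i ≠ j ∧ l i = l j := by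
  rw [mem_multipleEigenvalueSet_iff]
  change (∃ a ∈ eigenvalueMultiplicities H, 2 ≤ a) ↔ _
  rw [eigenvalueMultiplicities_eq_fiberCards h, fiberCards]
  constructor
  · rintro ⟨a, ha, ha2⟩
    obtain ⟨x, -, rfl⟩ := Multiset.mem_map.1 ha
    obtain ⟨i, hi, j, hj, hij⟩ := one_lt_card.1 (Nat.lt_of_succ_le ha2)
    exact ⟨i, j, hij, (mem_filter.1 hi).2.trans (mem_filter.1 hj).2.symm⟩
  · rintro ⟨i, j, hij, hl⟩
    exact ⟨_, Multiset.mem_map_of_mem _ (mem_image_of_mem l (mem_univ i)),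
      Nat.succ_le_of_lt (one_lt_card.2 ⟨i, by simp, j, by simp [hl], hij⟩)⟩

/-- A matrix with two equal eigenvalues is the limit of matrices for which all other coincidences of
eigenvalues are removed. -/
theorem exists_tendsto_stratumCodim_le {X : HermitianSpace N} (hX : X ∈ multipleEigenvalueSet N) :
    ∃ Y : ℝ → HermitianSpace N, Filter.Tendsto Y (𝓝[≠] 0) (𝓝 X) ∧
      (∀ t, Y t ∈ multipleEigenvalueSet N) ∧
      ∀ᶠ t in 𝓝[≠] 0, stratumCodim (eigenvalueType (Y t)) ≤ 3 := by
  obtain ⟨W, l, rfl⟩ := exists_eq_conjHermitian_diagonalHermitian X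
  obtain ⟨i, j, hij, hl⟩ :=
    (mem_multipleEigenvalueSet_iff_exists (spectrumMultiset_conjHermitian _ _)).1 hX
  -- the direction of the perturbation is injective except for `w i = w j`
  set w : Fin N → ℝ := fun a => if a = j then (i : ℕ) else (a : ℕ) with hw
  have hwij : w i = w j := by simp [hw]
  have hw_inj : ∀ a b, a ≠ j → b ≠ j → w a = w b → a = b := fun a b ha hb h => by
    simp only [hw, if_neg ha, if_neg hb, Nat.cast_inj] at h
    exact Fin.ext h
  have hwj : ∀ a, a ≠ j → w a = w j → a = i := fun a ha h => hw_inj a i ha hij (h.trans hwij.symm)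
  have hl_of_w : ∀ a b, w a = w b → l a = l b := by
    intro a b h
    by_cases ha : a = j <;> by_cases hb : b = j
    · rw [ha, hb]
    · rw [ha, hwj b hb (by rw [← h, ha]), hl]
    · rw [hb, hwj a ha (by rw [h, hb]), hl]
    · rw [hw_inj a b ha hb h]
  refine ⟨fun t => conjHermitian W (diagonalHermitian fun a => l a + t * w a), ?_, fun t => ?_, ?_⟩
  · have hd : Continuous fun t : ℝ => diagonalHermitian fun a => l a + t * w a :=
      Continuous.subtype_mk (Continuous.matrix_diagonal (by fun_prop)) _
    have hc : Continuous (conjHermitian W) :=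
      LinearMap.continuous_of_finiteDimensional (conjHermitian W).toLinearMap
    refine ((hc.comp hd).tendsto' 0 _ ?_).mono_left nhdsWithin_le_nhds
    simp
  · refine (mem_multipleEigenvalueSet_iff_exists (spectrumMultiset_conjHermitian _ _)).2
      ⟨i, j, hij, ?_⟩
    rw [hl, hwij]
  · have hev : ∀ᶠ t : ℝ in 𝓝[≠] 0, ∀ a b, l a + t * w a = l b + t * w b → w a = w b := by
      rw [Filter.eventually_all]
      intro a
      rw [Filter.eventually_all]
      intro b
      by_cases hab : w a = w b
      · exact Filter.Eventually.of_forall fun _ _ => hab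
      · by_cases hlab : l a = l b
        · filter_upwards [self_mem_nhdsWithin] with t ht h
          exact mul_left_cancel₀ ht (by linarith)
        · have hne : ∀ᶠ t : ℝ in 𝓝 0, l a + t * w a ≠ l b + t * w b :=
            ContinuousAt.eventually_ne (g := fun t : ℝ => l a + t * w a - (l b + t * w b)) (x := 0)
              (y := 0)
              (by fun_prop) (by simpa [sub_eq_zero] using hlab) |>.mono fun t h => sub_ne_zero.1 h
          exact (hne.filter_mono nhdsWithin_le_nhds).mono fun t h h' => absurd h' h
    filter_upwards [hev] with t ht
    rw [stratumCodim_eigenvalueType (spectrumMultiset_conjHermitian _ _)]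
    have h1 : #{p : Fin N × Fin N | l p.1 + t * w p.1 = l p.2 + t * w p.2} ≤ N + 2 := by
      have hsub : ({p : Fin N × Fin N | l p.1 + t * w p.1 = l p.2 + t * w p.2} : Finset _) ⊆
          (univ.image fun a : Fin N => (a, a)) ∪ {(i, j), (j, i)} := by
        rintro ⟨a, b⟩ hp
        have h := ht a b (mem_filter.1 hp).2
        simp only [mem_union, mem_image, mem_univ, true_and, mem_insert, mem_singleton,
          Prod.mk.injEq, exists_eq_left]
        by_cases ha : a = j <;> by_cases hb : b = j
        · exact .inl (ha.trans hb.symm)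
        · exact .inr (.inr ⟨ha, hwj b hb (by rw [← h, ha])⟩)
        · exact .inr (.inl ⟨hwj a ha (by rw [h, hb]), hb⟩)
        · exact .inl (hw_inj a b ha hb h)
      refine (card_le_card hsub).trans ((card_union_le _ _).trans (Nat.add_le_add ?_ card_le_two))
      simpa using card_image_le (s := (univ : Finset (Fin N))) (f := fun a => (a, a))
    have h2 : N - 1 ≤ #(univ.image fun a => l a + t * w a) := by
      have hinj : Set.InjOn (fun a => l a + t * w a) ((univ : Finset (Fin N)).erase j) :=
        fun a ha b hb h => hw_inj a b (ne_of_mem_erase ha) (ne_of_mem_erase hb) (ht a b h)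
      have := card_image_of_injOn hinj
      rw [card_erase_of_mem (mem_univ j), card_univ, Fintype.card_fin] at this
      rw [← this]
      exact card_le_card (image_subset_image (subset_univ _))
    have := i.pos
    omega

end Existence

/-! ### Genericity -/

section Generic

variable {N : ℕ}

theorem multipleEigenvalueSet_eq :
    multipleEigenvalueSet N = {H | 3 ≤ stratumCodim (eigenvalueType H)} := by
  ext H
  rw [mem_multipleEigenvalueSet_iff, isMultipleType_iff_three_le_stratumCodim]
  rfl

theorem closure_multiplicityStratum_subset (n : N.Partition) :
    closure (multiplicityStratum n) ⊆ {H | stratumCodim n ≤ stratumCodim (eigenvalueType H)} :=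
  closure_minimal (fun _ hH => (congrArg stratumCodim (mem_multiplicityStratum_iff.1 hH)).ge)
    (isClosed_setOf_le_stratumCodim _)

theorem genericallyAvoids_of_lt_stratumCodim {H₀ : HermitianSpace N} {S : Set (HermitianSpace N)}
    (hS : IsClosed S) (hH₀ : H₀ ∉ S) {d : ℕ}
    (hd : ∀ H ∈ S, d < stratumCodim (eigenvalueType H)) : GenericallyAvoids d H₀ S :=
  genericallyAvoids_of_subset_iUnion hS hH₀
    (ι := {n : N.Partition // d < stratumCodim n})
    (fun n => isSubmanifoldOfCodim_multiplicityStratum n.1)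
    (fun H hH => Set.mem_iUnion.2 ⟨⟨_, hd H hH⟩, mem_multiplicityStratum_iff.2 rfl⟩) fun n => n.2

theorem exists_isSingleDoubleType_iff {H : HermitianSpace N} (hH : H ∈ multipleEigenvalueSet N) :
    (∃ n : N.Partition, IsSingleDoubleType n ∧ H ∈ multiplicityStratum n) ↔
      stratumCodim (eigenvalueType H) ≤ 3 := by
  simp only [mem_multiplicityStratum_iff, exists_eq_right']
  refine ⟨fun h => h.stratumCodim_eq.le, fun h => ?_⟩
  by_contra hn
  exact h.not_gt ((mem_multipleEigenvalueSet_iff.1 hH).three_lt_stratumCodim hn)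

theorem isGeneric_isSingleDoubleType :
    IsGeneric (fun H : multipleEigenvalueSet N =>
      ∃ n : N.Partition, IsSingleDoubleType n ∧ (H : HermitianSpace N) ∈ multiplicityStratum n) := by
  simp only [IsGeneric, fun H : multipleEigenvalueSet N => exists_isSingleDoubleType_iff H.2]
  constructor
  · have := (isClosed_setOf_le_stratumCodim (N := N) 4).isOpen_compl.preimage
      (continuous_subtype_val (p := fun H => H ∈ multipleEigenvalueSet N))
    convert! this using 1
    ext H
    exact Nat.lt_succ_iff.symm.trans not_le.symm
  · intro X
    obtain ⟨Y, hY, hYV, hYc⟩ := exists_tendsto_stratumCodim_le X.2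
    exact mem_closure_of_tendsto (f := fun t => (⟨Y t, hYV t⟩ : multipleEigenvalueSet N))
      (tendsto_subtype_rng.2 hY) hYc

end Generic

theorem corollaryc (N : ℕ) (H₀ : HermitianSpace N) (hH₀ : H₀ ∉ multipleEigenvalueSet N) :
    -- families with fewer than three parameters generically reach no multiple eigenvalue
    (∀ d < 3, GenericallyAvoids d H₀ (multipleEigenvalueSet N)) ∧
    -- for `N ≥ 2`, three parameters do reach multiple eigenvalues, stably
    (2 ≤ N → StablyReaches 3 H₀ (multipleEigenvalueSet N)) ∧
    -- generically, a matrix with multiple eigenvalues has exactly one double eigenvalue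
    IsGeneric (fun H : multipleEigenvalueSet N =>
      ∃ n : N.Partition, IsSingleDoubleType n ∧ (H : HermitianSpace N) ∈ multiplicityStratum n) ∧
    -- for each multiplicity type, the number of parameters needed is the codimension of its
    -- stratum; it exceeds three except for exactly one double eigenvalue, where three suffice
    (∀ n : N.Partition, IsMultipleType n →
      (multiplicityStratum n).Nonempty ∧
      IsSubmanifoldOfCodim (multiplicityStratum n) (stratumCodim n) ∧
      (∀ d < stratumCodim n, GenericallyAvoids d H₀ (closure (multiplicityStratum n))) ∧
      (∀ d, stratumCodim n ≤ d → StablyReaches d H₀ (multiplicityStratum n)) ∧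
      (IsSingleDoubleType n → stratumCodim n = 3) ∧
      (¬ IsSingleDoubleType n → 3 < stratumCodim n)) := by

  have hreach : ∀ n : N.Partition, IsMultipleType n → ∀ d, stratumCodim n ≤ d →
      StablyReaches d H₀ (multiplicityStratum n) := fun n hn d hd =>
    (isSubmanifoldOfCodim_multiplicityStratum n).stablyReaches (multiplicityStratum_nonempty n) hd
      (by have := hn.three_le_stratumCodim; omega) H₀
  refine ⟨fun d hd => ?_, fun hN => ?_, isGeneric_isSingleDoubleType, fun n hn =>
    ⟨multiplicityStratum_nonempty n, isSubmanifoldOfCodim_multiplicityStratum n, fun d hd => ?_,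
      hreach n hn, fun h => h.stratumCodim_eq, hn.three_lt_stratumCodim⟩⟩
  · rw [multipleEigenvalueSet_eq] at hH₀ ⊢
    exact genericallyAvoids_of_lt_stratumCodim (isClosed_setOf_le_stratumCodim 3) hH₀
      fun H hH => hd.trans_le hH
  · -- a matrix near `0` with a stratum of codimension three
    obtain ⟨X, hX⟩ : (multipleEigenvalueSet N).Nonempty :=
      ⟨diagonalHermitian 0, (mem_multipleEigenvalueSet_iff_exists rfl).2
        ⟨⟨0, by omega⟩, ⟨1, by omega⟩, by simp, rfl⟩⟩
    obtain ⟨Y, -, hYV, hYc⟩ := exists_tendsto_stratumCodim_le hX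
    obtain ⟨t, ht⟩ := hYc.exists
    refine (hreach _ (mem_multipleEigenvalueSet_iff.1 (hYV t)) 3 ht).mono fun H hH => ?_
    rw [mem_multipleEigenvalueSet_iff, mem_multiplicityStratum_iff.1 hH]
    exact mem_multipleEigenvalueSet_iff.1 (hYV t)
  · refine genericallyAvoids_of_lt_stratumCodim isClosed_closure (fun h => hH₀ ?_)
      fun H hH => hd.trans_le (closure_multiplicityStratum_subset n hH)
    rw [multipleEigenvalueSet_eq]
    exact hn.three_le_stratumCodim.trans (closure_multiplicityStratum_subset n h)
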